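/- Let $w=w_0w_1w_2\cdots\in\{0,1\}^{\mathbb N}$ be a binary infinite word that is recurrent, i.e. each of its factors (finite, possibly empty, blocks of consecutive letters) occurs at infinitely many positions of $w$. For a factor $u$ of $w$ let $n_1<n_2<n_3<\cdots$ be all positions $n$ at which the block $w_n\cdots w_{n+|u|-1}$ is abelian equivalent to $u$ (i.e. is a permutation of $u$); the words $w_{n_i}w_{n_i+1}\cdots w_{n_{i+1}-1}$, $i\ge 1$, are called the semi-abelian returns to $u$ in $w$. Then $w$ is Sturmian, i.e. $w$ has exactly $n+1$ distinct factors of length $n$ for every $n\ge 0$, if and only if every factor $u$ of $w$ has exactly two or exactly three distinct semi-abelian returns in $w$. -/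

import Mathlib

namespace AbelianReturns

variable {α : Type*}

/-- The finite word `w_i w_{i+1} ⋯ w_{i+n-1}` of length `n` read in the infinite word `w`
from position `i` on. -/
def wordAt (w : ℕ → α) (i n : ℕ) : List α :=
  (List.range n).map fun k => w (i + k)

/-- The finite word `u` is a factor of the infinite word `w`: it occurs in `w` at some position. -/
def IsFactor (w : ℕ → α) (u : List α) : Prop :=
  ∃ i, wordAt w i u.length = u

/-- The infinite word `w` is recurrent: each of its factors occurs at infinitely many positions. -/
def Recurrent (w : ℕ → α) : Prop :=
  ∀ u, IsFactor w u → {i : ℕ | wordAt w i u.length = u}.Infinite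

/-- The factor complexity of `w`: the number of distinct factors of `w` of length `n`. -/
noncomputable def complexity (w : ℕ → α) (n : ℕ) : ℕ :=
  {u : List α | IsFactor w u ∧ u.length = n}.ncard

/-- The infinite word `w` is Sturmian: for every `n` it has exactly `n + 1` factors of
length `n`. -/
def Sturmian (w : ℕ → α) : Prop :=
  ∀ n, complexity w n = n + 1

/-- The positions of `w` at which a word abelian equivalent to `u` (that is, a permutation of `u`)
occurs. -/
def abelianOccurrences (w : ℕ → α) (u : List α) : Set ℕ :=
  {i | (wordAt w i u.length).Perm u}

/-- The semi-abelian returns to (the abelian class of) `u` in `w`: the words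
`w_i w_{i+1} ⋯ w_{j-1}`, where `i < j` are consecutive positions at which a word abelian
equivalent to `u` occurs. -/
def semiAbelianReturns (w : ℕ → α) (u : List α) : Set (List α) :=
  {r | ∃ i j, i < j ∧ i ∈ abelianOccurrences w u ∧ j ∈ abelianOccurrences w u ∧
    (∀ k, i < k → k < j → k ∉ abelianOccurrences w u) ∧ r = wordAt w i (j - i)}

end AbelianReturns

/-! Over two letters an abelian class of factors is a pair: the length `n` of a window and its sum
`c`. Everything is therefore stated for an integer sequence `v` with values 0 and 1. Recurrence
provides a return at every occurrence, moves any return arbitrarily far, and turns eventual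
periodicity into periodicity.

From Sturmian to returns. The complexity hypothesis says that each length has exactly one right
special factor; hence the word is aperiodic. It is also balanced: a shortest imbalance consists of
words 0u0 and 1u1 with u a palindrome, and the unique right special factor 0u or 1u, which must
occur in every short stretch, cannot fit into it (`MinUnbalanced.false_of_zero`). If a class had a
single return, the word would be a power of that return from some point on, so aperiodicity gives at
least two returns. A balanced aperiodic word has an irrational slope and from some position on codes
a rotation (`Balanced.exists_phase`). A class is then an interval of phases, and the three-gap
argument allows three displacements between consecutive visits (`IsPhase.exists_displacements`). A
displacement determines the return word (`IsPhase.sameSeg`), so there are at most three returns.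

From returns to Sturmian. The main point is balance (`balanced_of_returns`). At a shortest imbalance
the sums are c, c+1, c+2. The middle class is crossed upwards and downwards, which gives two returns
longer than one letter; the two one-letter returns cannot both be added. Up to exchanging letters
the return 1 is missing, and then the light windows consist of zeros. Counting returns now forces
blocks of one letter of constant length f and blocks of the other of exactly two lengths s < t, with
f ≥ 2 or t ≥ s+2. Such words are excluded by `RunForm.elim`: in each case some class has four
returns, usually two explicit short ones and two obtained by trimming the two distinct returns of
another class.

A balanced periodic word with least period p would have a class met once per period, hence with one
return (`AtLeastTwo.not_periodic`). So the word is aperiodic, which gives a right special factor of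
each length, and balance makes it unique. -/

namespace AbelianReturns

/-! ### Abelian classes as window sums, and their returns. -/

/-- The sum of the first `n` terms of `v`. -/
def psum (v : ℕ → ℤ) (n : ℕ) : ℤ := ∑ k ∈ Finset.range n, v k

/-- The sum of the window of length `n` of `v` at position `i`. -/
def wsum (v : ℕ → ℤ) (i n : ℕ) : ℤ := psum v (i + n) - psum v i

/-- All terms are `0` or `1`. -/
def Binary (v : ℕ → ℤ) : Prop := ∀ i, v i = 0 ∨ v i = 1

/-- Every block of `v` reappears arbitrarily far. -/
def Recur (v : ℕ → ℤ) : Prop := ∀ i n N, ∃ j, N ≤ j ∧ ∀ k < n, v (j + k) = v (i + k)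

/-- The positions `i < j` are consecutive positions of windows of length `n` and sum `c`. -/
def IsRet (v : ℕ → ℤ) (n : ℕ) (c : ℤ) (i j : ℕ) : Prop :=
  i < j ∧ wsum v i n = c ∧ wsum v j n = c ∧ ∀ k, i < k → k < j → wsum v k n ≠ c

/-- The blocks `[i, j)` and `[i', j')` of `v` carry the same word. -/
def SameSeg (v : ℕ → ℤ) (i j i' j' : ℕ) : Prop :=
  j - i = j' - i' ∧ ∀ k < j - i, v (i + k) = v (i' + k)

/-- No window class has four pairwise distinct return words. -/
def AtMostThree (v : ℕ → ℤ) : Prop :=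
  ∀ n c i₁ j₁ i₂ j₂ i₃ j₃ i₄ j₄, IsRet v n c i₁ j₁ → IsRet v n c i₂ j₂ → IsRet v n c i₃ j₃ →
    IsRet v n c i₄ j₄ → ¬ SameSeg v i₁ j₁ i₂ j₂ → ¬ SameSeg v i₁ j₁ i₃ j₃ →
    ¬ SameSeg v i₁ j₁ i₄ j₄ → ¬ SameSeg v i₂ j₂ i₃ j₃ → ¬ SameSeg v i₂ j₂ i₄ j₄ →
    ¬ SameSeg v i₃ j₃ i₄ j₄ → False

/-- Every nonempty window class has two distinct return words. -/
def AtLeastTwo (v : ℕ → ℤ) : Prop :=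
  ∀ n i, ∃ i₁ j₁ i₂ j₂, IsRet v n (wsum v i n) i₁ j₁ ∧ IsRet v n (wsum v i n) i₂ j₂ ∧
    ¬ SameSeg v i₁ j₁ i₂ j₂

/-- Any two windows of the same length have sums differing by at most one. -/
def Balanced (v : ℕ → ℤ) : Prop := ∀ n i j, wsum v i n ≤ wsum v j n + 1

/-- Exchange the letters `0` and `1`. -/
def compl (v : ℕ → ℤ) : ℕ → ℤ := fun i => 1 - v i

section basics
variable {v : ℕ → ℤ}

theorem psum_succ (n : ℕ) : psum v (n + 1) = psum v n + v n := by
  simp [psum, Finset.sum_range_succ]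

theorem wsum_zero (i : ℕ) : wsum v i 0 = 0 := by simp [wsum]

theorem wsum_succ (i n : ℕ) : wsum v i (n + 1) = wsum v i n + v (i + n) := by
  have := psum_succ (v := v) (i + n)
  simp only [wsum]
  rw [← add_assoc, this]; ring

theorem wsum_one (i : ℕ) : wsum v i 1 = v i := by
  have := wsum_succ (v := v) i 0
  rw [wsum_zero] at this; simpa using this

theorem wsum_add (i m n : ℕ) : wsum v i (m + n) = wsum v i m + wsum v (i + m) n := by
  simp only [wsum, ← add_assoc]; ring

theorem wsum_shift (i n : ℕ) : wsum v (i + 1) n = wsum v i n - v i + v (i + n) := by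
  have h1 := wsum_succ (v := v) i n
  have h2 := wsum_add (v := v) i 1 n
  rw [add_comm 1 n, wsum_one] at h2
  omega

theorem wsum_congr {i j n : ℕ} (h : ∀ k < n, v (i + k) = v (j + k)) :
    wsum v i n = wsum v j n := by
  induction n with
  | zero => simp [wsum_zero]
  | succ n ih =>
    rw [wsum_succ, wsum_succ, ih (fun k hk => h k (by omega)), h n (by omega)]

theorem psum_of_const {x : ℤ} {i j : ℕ} (hij : i ≤ j) (h : ∀ k, i ≤ k → k < j → v k = x) :
    psum v j = psum v i + (j - i) * x := by
  induction j, hij using Nat.le_induction with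
  | base => simp
  | succ j hj ih =>
    rw [psum_succ, ih (fun k h1 h2 => h k h1 (by omega)), h j hj (by omega)]
    push_cast; ring

theorem psum_zeros {i j : ℕ} (hij : i ≤ j) (h : ∀ k, i ≤ k → k < j → v k = 0) :
    psum v j = psum v i := by
  simpa using psum_of_const hij h

theorem psum_ones {i j : ℕ} (hij : i ≤ j) (h : ∀ k, i ≤ k → k < j → v k = 1) :
    psum v j = psum v i + j - i := by
  have := psum_of_const hij h
  rw [this]; ring

theorem Binary.le_of_le (hb : Binary v) {i j : ℕ} (hij : i ≤ j) :
    psum v i ≤ psum v j ∧ psum v j ≤ psum v i + j - i := by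
  induction j, hij using Nat.le_induction with
  | base => simp
  | succ j hj ih =>
    rw [psum_succ]
    rcases hb j with h | h <;> rw [h] <;> push_cast <;> omega

theorem Binary.zeros_of_psum (hb : Binary v) {i j k : ℕ} (h : psum v j = psum v i)
    (hik : i ≤ k) (hkj : k < j) : v k = 0 := by
  have h1 := hb.le_of_le hik
  have h2 := hb.le_of_le (show k + 1 ≤ j from hkj)
  rw [psum_succ] at h2
  rcases hb k with h | h <;> omega

theorem Binary.ones_of_psum (hb : Binary v) {i j k : ℕ} (h : psum v j = psum v i + j - i)
    (hik : i ≤ k) (hkj : k < j) : v k = 1 := by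
  have h1 := hb.le_of_le hik
  have h2 := hb.le_of_le (show k + 1 ≤ j from hkj)
  rw [psum_succ] at h2
  push_cast at h2
  rcases hb k with h | h <;> omega

theorem SameSeg.symm {i j i' j' : ℕ} (h : SameSeg v i j i' j') : SameSeg v i' j' i j :=
  ⟨h.1.symm, fun k hk => (h.2 k (by rw [h.1]; exact hk)).symm⟩

theorem SameSeg.trans {i j i' j' i'' j'' : ℕ} (h : SameSeg v i j i' j')
    (h' : SameSeg v i' j' i'' j'') : SameSeg v i j i'' j'' :=
  ⟨h.1.trans h'.1, fun k hk => (h.2 k hk).trans (h'.2 k (by rw [← h.1]; exact hk))⟩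

theorem not_sameSeg_of_ne {i j i' j' : ℕ} (k : ℕ) (hk : k < j - i) (h : v (i + k) ≠ v (i' + k)) :
    ¬ SameSeg v i j i' j' := fun H => h (H.2 k hk)

theorem not_sameSeg_of_length {i j i' j' : ℕ} (h : j - i ≠ j' - i') :
    ¬ SameSeg v i j i' j' := fun H => h H.1

/-- A return reappears arbitrarily far with the same word. -/
theorem IsRet.move (hr : Recur v) {n : ℕ} {c : ℤ} {i j : ℕ} (h : IsRet v n c i j) (N : ℕ) :
    ∃ i' j', N ≤ i' ∧ IsRet v n c i' j' ∧ SameSeg v i j i' j' := by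
  obtain ⟨i', hN, hi'⟩ := hr i (j - i + n) N
  obtain ⟨hij, h1, h2, h3⟩ := h
  have key : ∀ k, k ≤ j - i → wsum v (i' + k) n = wsum v (i + k) n := fun k hk =>
    wsum_congr fun l hl => by rw [add_assoc, add_assoc]; exact hi' _ (by omega)
  refine ⟨i', i' + (j - i), hN, ⟨by omega, ?_, ?_, ?_⟩, by omega, fun k hk => ?_⟩
  · simpa [h1] using key 0 (by omega)
  · rw [key _ le_rfl, show i + (j - i) = j by omega, h2]
  · intro k hk1 hk2
    have := key (k - i') (by omega)
    rw [show i' + (k - i') = k by omega] at this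
    rw [this]
    exact h3 _ (by omega) (by omega)
  · exact (hi' k (by omega)).symm

theorem Recur.exists_wsum (hr : Recur v) (n i N : ℕ) : ∃ j, N ≤ j ∧ wsum v j n = wsum v i n := by
  obtain ⟨j, hj, h⟩ := hr i n N
  exact ⟨j, hj, wsum_congr h⟩

/-- The return starting at an occurrence. -/
theorem Recur.exists_isRet (hr : Recur v) {n : ℕ} {c : ℤ} {i : ℕ} (h : wsum v i n = c) :
    ∃ j, IsRet v n c i j := by
  classical
  have hex : ∃ j, i < j ∧ wsum v j n = c := by
    obtain ⟨j, hj, h'⟩ := hr.exists_wsum n i (i + 1)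
    exact ⟨j, hj, h'.trans h⟩
  obtain ⟨h1, h2⟩ := Nat.find_spec hex
  exact ⟨Nat.find hex, h1, h, h2, fun k hk hk' H => Nat.find_min hex hk' ⟨hk, H⟩⟩

theorem AtLeastTwo.far (h : AtLeastTwo v) (hr : Recur v) (n i N : ℕ) :
    ∃ i₁ j₁ i₂ j₂, N ≤ i₁ ∧ N ≤ i₂ ∧ IsRet v n (wsum v i n) i₁ j₁ ∧
      IsRet v n (wsum v i n) i₂ j₂ ∧ ¬ SameSeg v i₁ j₁ i₂ j₂ := by
  obtain ⟨i₁, j₁, i₂, j₂, h1, h2, hne⟩ := h n i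
  obtain ⟨a₁, b₁, hN1, g1, s1⟩ := h1.move hr N
  obtain ⟨a₂, b₂, hN2, g2, s2⟩ := h2.move hr N
  exact ⟨a₁, b₁, a₂, b₂, hN1, hN2, g1, g2, fun H => hne ((s1.trans H).trans s2.symm)⟩

/-- Discrete intermediate value: a crossing from `≤ c` to `> c`. -/
theorem exists_cross_up {f : ℕ → ℤ} {c : ℤ} {a b : ℕ} (hab : a ≤ b) (ha : f a ≤ c) (hb : c < f b) :
    ∃ k, a ≤ k ∧ k < b ∧ f k ≤ c ∧ c < f (k + 1) := by
  induction b, hab using Nat.le_induction with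
  | base => omega
  | succ b hab ih =>
    by_cases h : c < f b
    · obtain ⟨k, h1, h2, h3⟩ := ih h
      exact ⟨k, h1, by omega, h3⟩
    · exact ⟨b, hab, by omega, by omega, hb⟩

theorem exists_cross_down {f : ℕ → ℤ} {c : ℤ} {a b : ℕ} (hab : a ≤ b) (ha : c ≤ f a)
    (hb : f b < c) : ∃ k, a ≤ k ∧ k < b ∧ c ≤ f k ∧ f (k + 1) < c := by
  obtain ⟨k, h1, h2, h3, h4⟩ := exists_cross_up (f := fun i => - f i) (c := -c) hab (by omega)
    (by omega)
  exact ⟨k, h1, h2, by omega, by omega⟩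

/-- A class with windows on both sides and with both one-letter returns has four returns. -/
theorem AtMostThree.fourWays (h3 : AtMostThree v) (hb : Binary v) (hr : Recur v) {n : ℕ} {c : ℤ}
    {i₀ i₁ a b : ℕ} (h0 : wsum v i₀ n = c) (h0' : v i₀ = 0) (h0'' : v (i₀ + n) = 0)
    (h1 : wsum v i₁ n = c) (h1' : v i₁ = 1) (h1'' : v (i₁ + n) = 1)
    (ha : wsum v a n < c) (hb' : c < wsum v b n) : False := by
  obtain ⟨b', hbb, hb''⟩ := hr.exists_wsum n b a
  obtain ⟨k, -, -, hk1, hk2⟩ := exists_cross_up (f := fun i => wsum v i n) (c := c) hbb ha.le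
    (by simp only [hb'']; exact hb')
  obtain ⟨a', haa, ha''⟩ := hr.exists_wsum n a b
  obtain ⟨l, -, -, hl1, hl2⟩ := exists_cross_down (f := fun i => wsum v i n) (c := c) haa hb'.le
    (by simp only [ha'']; exact ha)
  simp only [wsum_shift] at hk1 hk2 hl1 hl2
  -- A shift changes the sum by at most one, so the crossing starts exactly in the class `c`, loses
  -- a 0 and gains a 1. The next window is outside the class, so the return starting here is longer
  -- than one letter.
  have hvk : v k = 0 ∧ wsum v k n = c ∧ v (k + n) = 1 := by
    rcases hb k with h | h <;> rcases hb (k + n) with h' | h' <;>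
      refine ⟨?_, ?_, ?_⟩ <;> omega
  have hvl : v l = 1 ∧ wsum v l n = c ∧ v (l + n) = 0 := by
    rcases hb l with h | h <;> rcases hb (l + n) with h' | h' <;>
      refine ⟨?_, ?_, ?_⟩ <;> omega
  obtain ⟨jk, rk⟩ := hr.exists_isRet hvk.2.1
  obtain ⟨jl, rl⟩ := hr.exists_isRet hvl.2.1
  have hjk : k + 1 < jk := by
    have := rk.1
    rcases Nat.lt_or_ge (k + 1) jk with h | h
    · exact h
    · have : jk = k + 1 := by omega
      have h2 := rk.2.2.1
      rw [this, wsum_shift] at h2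
      omega
  have hjl : l + 1 < jl := by
    have := rl.1
    rcases Nat.lt_or_ge (l + 1) jl with h | h
    · exact h
    · have : jl = l + 1 := by omega
      have h2 := rl.2.2.1
      rw [this, wsum_shift] at h2
      omega
  have r0 : IsRet v n c i₀ (i₀ + 1) := ⟨by omega, h0, by rw [wsum_shift]; omega, by intros; omega⟩
  have r1 : IsRet v n c i₁ (i₁ + 1) := ⟨by omega, h1, by rw [wsum_shift]; omega, by intros; omega⟩
  refine h3 n c _ _ _ _ _ _ _ _ r0 r1 rk rl ?_ ?_ ?_ ?_ ?_ ?_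
  · exact not_sameSeg_of_ne 0 (by omega) (by simp [h0', h1'])
  · exact not_sameSeg_of_length (by omega)
  · exact not_sameSeg_of_length (by omega)
  · exact not_sameSeg_of_length (by omega)
  · exact not_sameSeg_of_length (by omega)
  · exact not_sameSeg_of_ne 0 (by omega) (by simp [hvk.1, hvl.1])

end basics

/-! ### Exchanging the two letters. -/

section complement
variable {v : ℕ → ℤ}

theorem compl_compl (v : ℕ → ℤ) : compl (compl v) = v := by
  funext i; simp [compl]

theorem Binary.compl (hb : Binary v) : Binary (compl v) := fun i => by
  rcases hb i with h | h <;> simp [AbelianReturns.compl, h]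

theorem Recur.compl (hr : Recur v) : Recur (compl v) := fun i n N => by
  obtain ⟨j, hj, h⟩ := hr i n N
  exact ⟨j, hj, fun k hk => by simp [AbelianReturns.compl, h k hk]⟩

theorem wsum_compl (i n : ℕ) : wsum (compl v) i n = n - wsum v i n := by
  induction n with
  | zero => simp [wsum_zero]
  | succ n ih => rw [wsum_succ, wsum_succ, ih, compl]; push_cast; ring

theorem isRet_compl {n : ℕ} {c : ℤ} {i j : ℕ} :
    IsRet (compl v) n c i j ↔ IsRet v n (n - c) i j := by
  have : ∀ x : ℤ, (n : ℤ) - x = c ↔ x = n - c := fun x => by omega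
  simp only [IsRet, wsum_compl, ne_eq, this]

theorem sameSeg_compl {i j i' j' : ℕ} : SameSeg (compl v) i j i' j' ↔ SameSeg v i j i' j' := by
  simp [SameSeg, compl]

theorem AtMostThree.compl (h : AtMostThree v) : AtMostThree (compl v) := by
  intro n c i₁ j₁ i₂ j₂ i₃ j₃ i₄ j₄
  simp only [isRet_compl, sameSeg_compl]
  exact h n _ i₁ j₁ i₂ j₂ i₃ j₃ i₄ j₄

theorem AtLeastTwo.compl (h : AtLeastTwo v) : AtLeastTwo (compl v) := by
  intro n i
  simp only [isRet_compl, sameSeg_compl, wsum_compl, sub_sub_cancel]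
  exact h n i

end complement

/-! ### Words with one length of zero blocks and two lengths of one blocks. -/

/-- The positions `i+1, …, i+r` form a maximal block of ones. -/
def OneRun (v : ℕ → ℤ) (i r : ℕ) : Prop :=
  v i = 0 ∧ (∀ k, i < k → k ≤ i + r → v k = 1) ∧ v (i + r + 1) = 0

/-- All maximal blocks of zeros have length `f`, all maximal blocks of ones have length `s` or `t`,
and both lengths occur. -/
structure RunForm (v : ℕ → ℤ) (f s t : ℕ) : Prop where
  zero : ∀ i, v i = 1 → v (i + 1) = 0 → (∀ k, i < k → k ≤ i + f → v k = 0) ∧ v (i + f + 1) = 1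
  one : ∀ i, v i = 0 → v (i + 1) = 1 → OneRun v i s ∨ OneRun v i t
  exists_short : ∃ i, OneRun v i s
  exists_long : ∃ i, OneRun v i t
  f_pos : 1 ≤ f
  s_pos : 1 ≤ s
  lt : s < t

section
variable {v : ℕ → ℤ} {f s t : ℕ}

theorem OneRun.psum_eq {i r x : ℕ} (h : OneRun v i r) (h1 : i < x) (h2 : x ≤ i + r + 1) :
    psum v x = psum v i + x - i - 1 := by
  have e1 := psum_succ (v := v) i
  have e2 := psum_ones (v := v) (i := i + 1) (j := x) h1 (fun k a b => h.2.1 k a (by omega))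
  rw [h.1] at e1
  push_cast at e2
  omega

theorem OneRun.unique {i r r' : ℕ} (h : OneRun v i r) (h' : OneRun v i r') : r = r' := by
  rcases lt_trichotomy r r' with hlt | hlt | hlt
  · have h1 := h'.2.1 (i + r + 1) (by omega) (by omega)
    have h2 := h.2.2
    omega
  · exact hlt
  · have h1 := h.2.1 (i + r' + 1) (by omega) (by omega)
    have h2 := h'.2.2
    omega

theorem OneRun.far {i r : ℕ} (hi : OneRun v i r) (hr : Recur v) (N : ℕ) :
    ∃ j, N ≤ j ∧ OneRun v j r := by
  obtain ⟨j, hj, h'⟩ := hr i (r + 2) N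
  refine ⟨j, hj, ?_, fun k h1 h2 => ?_, ?_⟩
  · simpa [hi.1] using h' 0 (by omega)
  · have := h' (k - j) (by omega)
    rw [show j + (k - j) = k by omega] at this
    rw [this]
    exact hi.2.1 _ (by omega) (by omega)
  · have := h' (r + 1) (by omega)
    rw [← add_assoc, ← add_assoc, hi.2.2] at this
    exact this

namespace RunForm

theorem zeros (h : RunForm v f s t) {i r : ℕ} (hr : 1 ≤ r) (hi : OneRun v i r) :
    (∀ k, i + r < k → k ≤ i + r + f → v k = 0) ∧ v (i + r + f + 1) = 1 :=
  h.zero (i + r) (hi.2.1 _ (by omega) le_rfl) hi.2.2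

theorem psum_gap (h : RunForm v f s t) {i r x : ℕ} (hr : 1 ≤ r) (hi : OneRun v i r)
    (h1 : i + r < x) (h2 : x ≤ i + r + f + 1) : psum v x = psum v i + r := by
  have e1 := hi.psum_eq (x := i + r + 1) (by omega) le_rfl
  have e2 := psum_zeros (v := v) (i := i + r + 1) (j := x) h1
    (fun k a b => (h.zeros hr hi).1 k a (by omega))
  push_cast at e1
  omega

theorem next (h : RunForm v f s t) {i r : ℕ} (hr : 1 ≤ r) (hi : OneRun v i r) :
    OneRun v (i + r + f) s ∨ OneRun v (i + r + f) t := by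
  obtain ⟨h1, h2⟩ := h.zeros hr hi
  have := h.f_pos
  exact h.one _ (h1 _ (by omega) le_rfl) h2

theorem cover (h : RunForm v f s t) {p₀ r₀ x : ℕ} (hr₀ : r₀ = s ∨ r₀ = t) (h₀ : OneRun v p₀ r₀)
    (hx : p₀ ≤ x) : ∃ p r, (r = s ∨ r = t) ∧ OneRun v p r ∧ p₀ ≤ p ∧ p ≤ x ∧ x < p + r + f := by
  have hs := h.s_pos
  have hlt := h.lt
  induction x, hx using Nat.le_induction with
  | base => exact ⟨p₀, r₀, hr₀, h₀, le_rfl, le_rfl, by omega⟩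
  | succ x hx ih =>
    obtain ⟨p, r, hr, hp, h0, h1, h2⟩ := ih
    by_cases hlt : x + 1 < p + r + f
    · exact ⟨p, r, hr, hp, h0, by omega, hlt⟩
    · have hx' : x + 1 = p + r + f := by omega
      rcases h.next (by omega) hp with h' | h'
      · exact ⟨_, s, Or.inl rfl, h', by omega, by omega, by omega⟩
      · exact ⟨_, t, Or.inr rfl, h', by omega, by omega, by omega⟩

/-- A run after the start `p` of another one starts no earlier than the next run after `p`. -/
theorem le_of_lt (h : RunForm v f s t) {p r i q : ℕ} (hr : 1 ≤ r) (hp : OneRun v p r) (hq : 1 ≤ q)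
    (hi : OneRun v i q) (hpi : p < i) : p + r + f ≤ i := by
  by_contra hlt
  have a := hi.1
  have b := hi.2.1 (i + 1) (by omega) (by omega)
  rcases Nat.lt_or_ge (p + r) i with h1 | h1
  · have := (h.zeros hr hp).1 (i + 1) (by omega) (by omega)
    omega
  · have := hp.2.1 i hpi h1
    omega

theorem prev (h : RunForm v f s t) {p₀ r₀ i r : ℕ} (hr₀ : r₀ = s ∨ r₀ = t) (h₀ : OneRun v p₀ r₀)
    (hr : r = s ∨ r = t) (hi : OneRun v i r) (hlt : p₀ < i) :
    ∃ p q, (q = s ∨ q = t) ∧ OneRun v p q ∧ p₀ ≤ p ∧ p + q + f = i := by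
  have hs := h.s_pos
  have ht := h.lt
  obtain ⟨p, q, hq, hp, h0, h1, h2⟩ := h.cover hr₀ h₀ (x := i - 1) (by omega)
  have := h.le_of_lt (by omega) hp (by omega) hi (by omega)
  exact ⟨p, q, hq, hp, h0, by omega⟩

/-- Somewhere a short run is followed by a long one, and conversely. -/
theorem exists_switch (h : RunForm v f s t) (hr : Recur v) (N : ℕ) {a b : ℕ}
    (hab : (a = s ∧ b = t) ∨ (a = t ∧ b = s)) :
    ∃ p, N ≤ p ∧ OneRun v p a ∧ OneRun v (p + a + f) b := by
  have hs := h.s_pos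
  have ht := h.lt
  have key : ∃ i, OneRun v i a := by
    rcases hab with ⟨rfl, rfl⟩ | ⟨rfl, rfl⟩
    exacts [h.exists_short, h.exists_long]
  have key' : ∃ i, OneRun v i b := by
    rcases hab with ⟨rfl, rfl⟩ | ⟨rfl, rfl⟩
    exacts [h.exists_long, h.exists_short]
  obtain ⟨i, hi⟩ := key
  obtain ⟨i, hN, hi⟩ := hi.far hr N
  obtain ⟨j, hj⟩ := key'
  obtain ⟨j, hij, hj⟩ := hj.far hr (i + 1)
  have : ∀ n, ∀ i, N ≤ i → OneRun v i a → i < j → j - i ≤ n →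
      ∃ p, N ≤ p ∧ OneRun v p a ∧ OneRun v (p + a + f) b := by
    intro n
    induction n with
    | zero => intros; omega
    | succ n ih =>
      intro i hN hi hlt hn
      have h1 := h.le_of_lt (by omega) hi (by omega : 1 ≤ b) hj hlt
      have h2 : OneRun v (i + a + f) a ∨ OneRun v (i + a + f) b := by
        rcases hab with ⟨rfl, rfl⟩ | ⟨rfl, rfl⟩
        · exact h.next (by omega) hi
        · exact (h.next (by omega) hi).symm
      rcases h2 with h2 | h2
      · rcases Nat.eq_or_lt_of_le h1 with h3 | h3
        · rw [h3] at h2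
          have := h2.unique hj
          omega
        · exact ih _ (by omega) h2 h3 (by omega)
      · exact ⟨i, hN, hi, h2⟩
  exact this (j - i) i hN hi (by omega) le_rfl

end RunForm

theorem isRet_one {n : ℕ} {c : ℤ} {i : ℕ} (h : wsum v i n = c) (h' : wsum v (i + 1) n = c) :
    IsRet v n c i (i + 1) := ⟨by omega, h, h', by intros; omega⟩

/-! ### Excluding zero blocks of length at least two. -/

namespace RunForm

/-- Four returns to the class of 0^f 1^t 0. Before a long block, a block of length r = s or r = t
gives the return 0 1^r; these are two. The return 0 follows 0^f 1^t 0 because another zero comes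
next, as f ≥ 2. A last return starts with 1, at the window 1^(t-s) 0^f 1^s 0 where a long block
meets a short one. -/
theorem false_of_two_le_of_long_long (h : RunForm v f s t) (hr : Recur v) (h3 : AtMostThree v)
    (hf : 2 ≤ f) {i : ℕ} (hi : OneRun v i t) (hi' : OneRun v (i + t + f) t) : False := by
  have hs := h.s_pos
  have ht := h.lt
  have main : ∀ j r, (r = s ∨ r = t) → OneRun v j r → OneRun v (j + r + f) t →
      IsRet v (f + 1 + t) t j (j + r + 1) := by
    intro j r hrr hj hj'
    have e1 := psum_succ (v := v) j
    rw [hj.1] at e1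
    have e2 := h.psum_gap (by omega) hj (x := j + r + f) (by omega) (by omega)
    refine ⟨by omega, ?_, ?_, ?_⟩
    · rcases hrr with rfl | rfl
      · have := hj'.psum_eq (x := j + (f + 1 + t)) (by omega) (by omega)
        simp only [wsum]; omega
      · have := h.psum_gap (by omega) hj (x := j + (f + 1 + r)) (by omega) (by omega)
        simp only [wsum]; omega
    · have := h.psum_gap (by omega) hj' (x := j + r + 1 + (f + 1 + t)) (by omega) (by omega)
      have := h.psum_gap (by omega) hj (x := j + r + 1) (by omega) (by omega)
      simp only [wsum]; omega
    -- In between, the window loses ones of the first block at the rate at which it gains ones of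
    -- the second, so its sum stays t + 1.
    · intro k h1 h2
      have := hj.psum_eq (x := k) (by omega) (by omega)
      have := hj'.psum_eq (x := k + (f + 1 + t)) (by omega) (by omega)
      simp only [wsum]; omega
  obtain ⟨p, -, hp, hp'⟩ := h.exists_switch hr 0 (Or.inl ⟨rfl, rfl⟩)
  obtain ⟨q, -, hq, hq'⟩ := h.exists_switch hr 0 (Or.inr ⟨rfl, rfl⟩)
  have r1 := main i t (Or.inr rfl) hi hi'
  have r2 := main p s (Or.inl rfl) hp hp'
  have r3 : IsRet v (f + 1 + t) t (i + t + 1) (i + t + 2) := by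
    refine isRet_one r1.2.2.1 ?_
    have := h.psum_gap (by omega) hi' (x := i + t + 1 + 1 + (f + 1 + t)) (by omega) (by omega)
    have := h.psum_gap (by omega) hi (x := i + t + 1 + 1) (by omega) (by omega)
    have := h.psum_gap (by omega) hi (x := i + t + f) (by omega) (by omega)
    simp only [wsum]; omega
  obtain ⟨j, r4⟩ : ∃ j, IsRet v (f + 1 + t) t (q + s + 1) j := by
    apply hr.exists_isRet
    have := h.psum_gap (by omega) hq' (x := q + s + 1 + (f + 1 + t)) (by omega) (by omega)
    have := hq.psum_eq (x := q + s + 1) (by omega) (by omega)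
    have := h.psum_gap (by omega) hq (x := q + t + f) (by omega) (by omega)
    simp only [wsum]; omega
  have a4 : v (q + s + 1) = 1 := hq.2.1 _ (by omega) (by omega)
  have a3 : v (i + t + 1) = 0 := hi.2.2
  have := r4.1
  refine h3 _ _ _ _ _ _ _ _ _ _ r1 r2 r3 r4 ?_ ?_ ?_ ?_ ?_ ?_
  · exact not_sameSeg_of_length (by omega)
  · exact not_sameSeg_of_length (by omega)
  · exact not_sameSeg_of_ne 0 (by omega) (by simp [hi.1, a4])
  · exact not_sameSeg_of_length (by omega)
  · exact not_sameSeg_of_ne 0 (by omega) (by simp [hp.1, a4])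
  · exact not_sameSeg_of_ne 0 (by omega) (by simp [a3, a4])

/-- Returns to the class of the longest blocks of ones. -/
theorem oneRun_of_isRet (h : RunForm v f s t) (hb : Binary v) {i j : ℕ}
    {p₀ : ℕ} (h₀ : OneRun v p₀ t) (hi : p₀ < i)
    (hij : IsRet v t t i j) : OneRun v (i - 1) t ∧ OneRun v (j - 1) t ∧
      ∀ k, i ≤ k → k < j - 1 → ¬ OneRun v k t := by
  have hs := h.s_pos
  have ht := h.lt
  have key : ∀ i, p₀ < i → wsum v i t = t → OneRun v (i - 1) t := by
    intro i hi hw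
    have ones : ∀ k, i ≤ k → k < i + t → v k = 1 := fun k h1 h2 =>
      hb.ones_of_psum (i := i) (j := i + t) (by simp only [wsum] at hw; push_cast; omega) h1 h2
    obtain ⟨p, r, hrr, hp, -, h1, h2⟩ := h.cover (Or.inr rfl) h₀ (x := i) hi.le
    have e1 := ones i le_rfl (by omega)
    have h5 : p ≠ i := by rintro rfl; have := hp.1; omega
    have h6 : i ≤ p + r := by
      by_contra hlt
      have := (h.zeros (by omega) hp).1 i (by omega) (by omega)
      omega
    have h7 : i = p + 1 ∧ r = t := by
      by_contra hne
      have := ones (p + r + 1) (by omega) (by omega)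
      have := hp.2.2
      omega
    obtain ⟨rfl, rfl⟩ := h7
    simpa using hp
  obtain ⟨h1, h2, h3, h4⟩ := hij
  refine ⟨key i hi h2, key j (by omega) h3, fun k hk1 hk2 hk => ?_⟩
  apply h4 (k + 1) (by omega) (by omega)
  have := hk.psum_eq (x := k + 1 + t) (by omega) (by omega)
  have := hk.psum_eq (x := k + 1) (by omega) (by omega)
  simp only [wsum]; push_cast at *; omega

end RunForm
end

section
variable {v : ℕ → ℤ} {f s t : ℕ}
namespace RunForm

theorem next_short (h : RunForm v f s t) (hBB : ∀ i, OneRun v i t → ¬ OneRun v (i + t + f) t)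
    {i : ℕ} (hi : OneRun v i t) : OneRun v (i + t + f) s := by
  have hs := h.s_pos
  have ht := h.lt
  exact (h.next (by omega) hi).resolve_right (hBB i hi)

theorem prev_short (h : RunForm v f s t) (hBB : ∀ i, OneRun v i t → ¬ OneRun v (i + t + f) t)
    {p₀ i : ℕ} (h₀ : OneRun v p₀ t) (hi : OneRun v i t) (hlt : p₀ < i) :
    ∃ p, p₀ ≤ p ∧ p + s + f = i ∧ OneRun v p s := by
  obtain ⟨p, q, hq, hp, hp0, rfl⟩ := h.prev (Or.inr rfl) h₀ (Or.inr rfl) hi hlt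
  rcases hq with rfl | rfl
  · exact ⟨p, hp0, rfl, hp⟩
  · exact absurd hi (hBB p hp)

/-- Such a window has f + 1 zeros. As f ≥ 2, they are one whole gap and one further zero at an end
of the window. The remaining s + t ones come from the two blocks around the gap, which are not both
long, so they are one short and one long block, both complete. -/
theorem occ_of_two_le (h : RunForm v f s t) (hb : Binary v) (hf : 2 ≤ f)
    (hBB : ∀ i, OneRun v i t → ¬ OneRun v (i + t + f) t) {p₀ k : ℕ} (h₀ : OneRun v p₀ t)
    (hk : p₀ ≤ k) (hw : wsum v k (s + t + f + 1) = s + t) :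
    ∃ p, p₀ ≤ p ∧ (k = p ∨ k = p + 1) ∧ ((OneRun v p s ∧ OneRun v (p + s + f) t) ∨
      (OneRun v p t ∧ OneRun v (p + t + f) s)) := by
  have hs := h.s_pos
  have ht := h.lt
  obtain ⟨p, r, hr, hp, hp0, h1, h2⟩ := h.cover (Or.inr rfl) h₀ hk
  have hr1 : 1 ≤ r := by omega
  obtain ⟨r', hr', hp', hcase⟩ : ∃ r', (r' = s ∨ r' = t) ∧ OneRun v (p + r + f) r' ∧
      ¬ (r = t ∧ r' = t) := by
    rcases h.next hr1 hp with h' | h'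
    · exact ⟨s, Or.inl rfl, h', by omega⟩
    · refine ⟨t, Or.inr rfl, h', ?_⟩
      rintro ⟨rfl, -⟩
      exact hBB p hp h'
  obtain ⟨r'', hr'', hp''⟩ : ∃ r'', (r'' = s ∨ r'' = t) ∧ OneRun v (p + r + f + r' + f) r'' := by
    rcases h.next (by omega) hp' with h' | h'
    exacts [⟨s, Or.inl rfl, h'⟩, ⟨t, Or.inr rfl, h'⟩]
  by_cases hgoal : (k = p ∨ k = p + 1) ∧ ((r = s ∧ r' = t) ∨ (r = t ∧ r' = s))
  · rcases hgoal.2 with ⟨rfl, rfl⟩ | ⟨rfl, rfl⟩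
    exacts [⟨p, hp0, hgoal.1, Or.inl ⟨hp, hp'⟩⟩, ⟨p, hp0, hgoal.1, Or.inr ⟨hp, hp'⟩⟩]
  exfalso
  simp only [wsum] at hw
  have a1 := h.psum_gap hr1 hp (x := p + r + f) (by omega) (by omega)
  have a2 := h.psum_gap (by omega) hp' (x := p + r + f + r' + f) (by omega) (by omega)
  have b1 : (k = p ∧ psum v k = psum v p) ∨
      (p < k ∧ k ≤ p + r ∧ psum v k = psum v p + k - p - 1) ∨
      (p + r + 1 ≤ k ∧ psum v k = psum v p + r) := by
    rcases Nat.eq_or_lt_of_le h1 with rfl | h1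
    · exact Or.inl ⟨rfl, rfl⟩
    · rcases Nat.lt_or_ge (p + r) k with h3 | h3
      · exact Or.inr (Or.inr ⟨by omega, h.psum_gap hr1 hp (by omega) (by omega)⟩)
      · exact Or.inr (Or.inl ⟨h1, h3, hp.psum_eq h1 (by omega)⟩)
  generalize hE : k + (s + t + f + 1) = e at hw
  have b2 : (e ≤ p + r + f + r' ∧ psum v e = psum v (p + r + f) + e - (p + r + f) - 1) ∨
      (p + r + f + r' < e ∧ e ≤ p + r + f + r' + f + 1 ∧ psum v e = psum v (p + r + f) + r') ∨
      (p + r + f + r' + f + 1 < e ∧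
        psum v e ≤ psum v (p + r + f + r' + f) + e - (p + r + f + r' + f + 1)) := by
    rcases Nat.lt_or_ge (p + r + f + r') e with h3 | h3
    · rcases Nat.lt_or_ge (p + r + f + r' + f + 1) e with h4 | h4
      · have h5 := (hb.le_of_le h4.le).2
        have h6 := psum_succ (v := v) (p + r + f + r' + f)
        rw [hp''.1] at h6
        right; right
        push_cast at h5
        omega
      · exact Or.inr (Or.inl ⟨h3, h4, h.psum_gap (by omega) hp' (by omega) (by omega)⟩)
    · left
      have := hp'.psum_eq (x := e) (by omega) (by omega)
      push_cast at this
      omega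
  rcases b1 with ⟨c1, c2⟩ | ⟨c1, c2, c3⟩ | ⟨c1, c3⟩ <;>
  rcases b2 with ⟨d1, d2⟩ | ⟨d1, d2, d3⟩ | ⟨d1, d2⟩ <;>
  rcases hr with rfl | rfl <;> rcases hr' with rfl | rfl <;> omega

/-- The class of 0 1^s 0^f 1^t has the returns 0 and 1^s 0^(f-1). By hypothesis the class of 1^t has
two distinct returns. Each of them ends with 0 1^s 0^f, since a short block precedes every long one
met later; without this suffix it becomes a return of the first class. The suffix being common, the
trimmed returns remain distinct. -/
theorem false_of_two_le (h : RunForm v f s t) (hb : Binary v) (hr : Recur v)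
    (h3 : AtMostThree v) (h2 : AtLeastTwo v) (hf : 2 ≤ f)
    (hBB : ∀ i, OneRun v i t → ¬ OneRun v (i + t + f) t) : False := by
  have hs := h.s_pos
  have ht := h.lt
  obtain ⟨p₀, h₀⟩ := h.exists_long
  have w0 : ∀ p, OneRun v p s → OneRun v (p + s + f) t → wsum v p (s + t + f + 1) = s + t := by
    intro p hp hq
    have a1 := h.psum_gap hs hp (x := p + s + f) (by omega) (by omega)
    have a2 := hq.psum_eq (x := p + (s + t + f + 1)) (by omega) (by omega)
    simp only [wsum]; omega
  have w1 : ∀ p, OneRun v p s → OneRun v (p + s + f) t →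
      wsum v (p + 1) (s + t + f + 1) = s + t := by
    intro p hp hq
    have a1 := h.psum_gap hs hp (x := p + s + f) (by omega) (by omega)
    have a2 := h.psum_gap (by omega) hq (x := p + 1 + (s + t + f + 1)) (by omega) (by omega)
    have a3 := hp.psum_eq (x := p + 1) (by omega) (by omega)
    simp only [wsum]; omega
  have u0 : ∀ p, OneRun v p t → OneRun v (p + t + f) s → wsum v p (s + t + f + 1) = s + t := by
    intro p hp hq
    have a1 := h.psum_gap (by omega) hp (x := p + t + f) (by omega) (by omega)
    have a2 := hq.psum_eq (x := p + (s + t + f + 1)) (by omega) (by omega)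
    simp only [wsum]; omega
  have u1 : ∀ p, OneRun v p t → OneRun v (p + t + f) s →
      wsum v (p + 1) (s + t + f + 1) = s + t := by
    intro p hp hq
    have a1 := h.psum_gap (by omega) hp (x := p + t + f) (by omega) (by omega)
    have a2 := h.psum_gap hs hq (x := p + 1 + (s + t + f + 1)) (by omega) (by omega)
    have a3 := hp.psum_eq (x := p + 1) (by omega) (by omega)
    simp only [wsum]; omega
  obtain ⟨x₁, y₁, x₂, y₂, N1, N2, R1, R2, hne⟩ := h2.far hr t (p₀ + 1) (p₀ + 1)
  have hwt : wsum v (p₀ + 1) t = t := by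
    have a1 := h₀.psum_eq (x := p₀ + 1) (by omega) (by omega)
    have a2 := h₀.psum_eq (x := p₀ + 1 + t) (by omega) (by omega)
    simp only [wsum]; omega
  rw [hwt] at R1 R2
  have long : ∀ x y, p₀ + 1 ≤ x → IsRet v t t x y →
      IsRet v (s + t + f + 1) (s + t) x (y - 1 - s - f) ∧ x + f + s + 1 < y ∧ v x = 1 ∧ v (x + 1) = 1 ∧
      ∃ q, q + s + f + 1 = y ∧ OneRun v q s ∧ OneRun v (q + s + f) t := by
    intro x y hx R
    obtain ⟨g1, g2, g3⟩ := h.oneRun_of_isRet hb h₀ hx R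
    have hxy := R.1
    have g4 := h.le_of_lt (by omega) g1 (by omega) g2 (by omega)
    obtain ⟨q, hq0, hq1, hq2⟩ := h.prev_short hBB g1 g2 (by omega)
    have g5 := h.next_short hBB g1
    have g6 : q ≠ x - 1 := by
      rintro rfl
      have := hq2.unique g1
      omega
    have g7 := h.le_of_lt (by omega) g1 (by omega) hq2 (by omega)
    rw [← hq1] at g2
    have g8 : y - 1 - s - f = q := by omega
    refine ⟨?_, by omega, ?_, ?_, q, by omega, hq2, g2⟩
    · rw [g8]
      refine ⟨by omega, ?_, w0 q hq2 g2, ?_⟩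
      · have := u1 _ g1 g5
        rwa [show x - 1 + 1 = x by omega] at this
      · intro k hk1 hk2 hw
        obtain ⟨p, hp0, hkp, hp⟩ := h.occ_of_two_le hb hf hBB h₀ (by omega) hw
        rcases hp with ⟨hp, hp'⟩ | ⟨hp, hp'⟩
        · exact g3 (p + s + f) (by omega) (by omega) hp'
        · exact g3 p (by
            rcases Nat.lt_or_ge p x with h | h
            · have : p = x - 1 := by omega
              omega
            · exact h) (by omega) hp
    · exact g1.2.1 x (by omega) (by omega)
    · exact g1.2.1 (x + 1) (by omega) (by omega)
  obtain ⟨L1, l1, a1, a1', q₁, e1, s1, t1⟩ := long x₁ y₁ N1 R1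
  obtain ⟨L2, l2, a2, a2', q₂, e2, s2, t2⟩ := long x₂ y₂ N2 R2
  have hz1 := (h.zeros hs s1).1
  have hz2 := (h.zeros hs s2).1
  -- the one-letter return and the return joining a short-long pair to the next one
  have r3 := isRet_one (w0 q₁ s1 t1) (w1 q₁ s1 t1)
  have r4 : IsRet v (s + t + f + 1) (s + t) (q₁ + 1) (q₁ + s + f) := by
    refine ⟨by omega, w1 q₁ s1 t1, u0 _ t1 (h.next_short hBB t1), ?_⟩
    intro k hk1 hk2 hw
    obtain ⟨p, hp0, hkp, hp⟩ := h.occ_of_two_le hb hf hBB h₀ (by omega) hw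
    have := R1.1
    rcases hp with ⟨hp, -⟩ | ⟨hp, -⟩
    · rcases Nat.lt_or_ge q₁ p with h' | h'
      · have := h.le_of_lt hs s1 hs hp h'
        omega
      · omega
    · rcases Nat.lt_or_ge q₁ p with h' | h'
      · have := h.le_of_lt hs s1 (by omega) hp h'
        omega
      · have : p = q₁ := by omega
        subst this
        have := hp.unique s1
        omega
  have z1 : v (q₁ + s + 1) = 0 := s1.2.2
  have o1 : v (q₁ + 1) = 1 := s1.2.1 _ (by omega) (by omega)
  have long_ne : ∀ x y, p₀ + 1 ≤ x → IsRet v t t x y →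
      ¬ SameSeg v x (y - 1 - s - f) (q₁ + 1) (q₁ + s + f) := by
    intro x y hx R hS
    obtain ⟨g1, g2, g3⟩ := h.oneRun_of_isRet hb h₀ hx R
    have e := hS.2 s (by have := hS.1; omega)
    rw [g1.2.1 (x + s) (by omega) (by omega), show q₁ + 1 + s = q₁ + s + 1 by omega, z1] at e
    omega
  refine h3 _ _ _ _ _ _ _ _ _ _ r3 r4 L1 L2 ?_ ?_ ?_ ?_ ?_ ?_
  · exact not_sameSeg_of_ne 0 (by omega) (by simp [s1.1, o1])
  · exact not_sameSeg_of_ne 0 (by omega) (by simp [s1.1, a1])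
  · exact not_sameSeg_of_ne 0 (by omega) (by simp [s1.1, a2])
  · exact fun H => long_ne x₁ y₁ N1 R1 H.symm
  · exact fun H => long_ne x₂ y₂ N2 R2 H.symm
  · intro hS
    apply hne
    have hl := hS.1
    refine ⟨by omega, fun k hk => ?_⟩
    rcases Nat.lt_or_ge k (y₁ - 1 - s - f - x₁) with hk' | hk'
    · exact hS.2 k hk'
    -- The removed suffixes are both 0 1^s 0^f, so equal trimmed returns would have equal originals.
    · have key : ∀ m, m < s + f + 1 → v (q₁ + m) = v (q₂ + m) := by
        intro m hm
        rcases Nat.eq_zero_or_pos m with rfl | hm0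
        · simp [s1.1, s2.1]
        rcases Nat.lt_or_ge s m with h' | h'
        · rw [hz1 _ (by omega) (by omega), hz2 _ (by omega) (by omega)]
        · rw [s1.2.1 _ (by omega) (by omega), s2.2.1 _ (by omega) (by omega)]
      have := key (x₁ + k - q₁) (by omega)
      rw [show q₁ + (x₁ + k - q₁) = x₁ + k by omega,
        show q₂ + (x₁ + k - q₁) = x₂ + k by omega] at this
      exact this

end RunForm
end

/-! ### Zero blocks of length one, with t ≥ s + 2. -/

section
variable {v : ℕ → ℤ} {f s t : ℕ}
namespace RunForm

/-- In the class of 0 1^s 0 1^t both one-letter returns occur, at the first two positions of a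
short-long pair. Two short blocks give a lighter window with three zeros; two long ones give a
heavier window with a single zero. -/
theorem false_of_short_short_of_long_long (h : RunForm v 1 s t) (hb : Binary v) (hr : Recur v)
    (h3 : AtMostThree v) (hst : s + 2 ≤ t) {i j : ℕ} (hi : OneRun v i s)
    (hi' : OneRun v (i + s + 1) s) (hj : OneRun v j t) (hj' : OneRun v (j + t + 1) t) : False := by
  have hs := h.s_pos
  obtain ⟨p, -, hp, hp'⟩ := h.exists_switch hr 0 (Or.inl ⟨rfl, rfl⟩)
  have e0 := h.psum_gap hs hp (x := p + s + 1) (by omega) (by omega)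
  have e1 := hp'.psum_eq (x := p + (s + t + 2)) (by omega) (by omega)
  have e2 := h.psum_gap (by omega) hp' (x := p + 1 + (s + t + 2)) (by omega) (by omega)
  have e3 := hp.psum_eq (x := p + 1) (by omega) (by omega)
  have z2 := h.zeros (by omega) hp'
  obtain ⟨q, hq⟩ : ∃ q, OneRun v (i + s + 1 + s + 1) q ∧ (q = s ∨ q = t) := by
    rcases h.next hs hi' with h' | h'
    exacts [⟨s, h', Or.inl rfl⟩, ⟨t, h', Or.inr rfl⟩]
  refine h3.fourWays hb hr (n := s + t + 2) (c := s + t) (i₀ := p) (i₁ := p + 1) (a := i)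
    (b := j + 2) ?_ hp.1 ?_ ?_ (hp.2.1 _ (by omega) (by omega)) ?_ ?_ ?_
  · simp only [wsum]; omega
  · rw [show p + (s + t + 2) = p + s + 1 + t + 1 by omega]; exact hp'.2.2
  · simp only [wsum]; omega
  · rw [show p + 1 + (s + t + 2) = p + s + 1 + t + 1 + 1 by omega]; exact z2.2
  · have f1 := h.psum_gap hs hi (x := i + s + 1) (by omega) (by omega)
    have f2 := h.psum_gap hs hi' (x := i + s + 1 + s + 1) (by omega) (by omega)
    have f3 := hq.1.psum_eq (x := i + s + 1 + s + 1 + 1) (by omega) (by omega)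
    have f4 := (hb.le_of_le (i := i + s + 1 + s + 1 + 1) (j := i + (s + t + 2)) (by omega)).2
    simp only [wsum]; push_cast at f3 f4; omega
  · have f1 := h.psum_gap (by omega) hj (x := j + t + 1) (by omega) (by omega)
    have f2 := hj'.psum_eq (x := j + 2 + (s + t + 2)) (by omega) (by omega)
    have f3 := hj.psum_eq (x := j + 2) (by omega) (by omega)
    simp only [wsum]; push_cast at f2 f3; omega

/-- Such a window has exactly one zero, so its s + t - 1 ones lie in two adjacent blocks. Two short
blocks are too small because t ≥ s + 2, and two long ones are excluded. A short-long pair has s + t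
ones, so one is missing at one of the two ends. -/
theorem occ_of_one (h : RunForm v 1 s t) (hb : Binary v) (hst : s + 2 ≤ t)
    (hBB : ∀ i, OneRun v i t → ¬ OneRun v (i + t + 1) t) {p₀ k : ℕ} (h₀ : OneRun v p₀ t)
    (hk : p₀ < k) (hw : wsum v k (s + t) = s + t - 1) :
    ∃ p, p₀ ≤ p ∧ (k = p + 1 ∨ k = p + 2) ∧ ((OneRun v p s ∧ OneRun v (p + s + 1) t) ∨
      (OneRun v p t ∧ OneRun v (p + t + 1) s)) := by
  have hs := h.s_pos
  obtain ⟨p, r, hr, hp, hp0, h1, h2⟩ := h.cover (Or.inr rfl) h₀ (x := k - 1) (by omega)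
  have hr1 : 1 ≤ r := by omega
  obtain ⟨r', hr', hp', hcase⟩ : ∃ r', (r' = s ∨ r' = t) ∧ OneRun v (p + r + 1) r' ∧
      ¬ (r = t ∧ r' = t) := by
    rcases h.next hr1 hp with h' | h'
    · exact ⟨s, Or.inl rfl, h', by omega⟩
    · refine ⟨t, Or.inr rfl, h', ?_⟩
      rintro ⟨rfl, -⟩
      exact hBB p hp h'
  by_cases hgoal : (k = p + 1 ∨ k = p + 2) ∧ ((r = s ∧ r' = t) ∨ (r = t ∧ r' = s))
  · rcases hgoal.2 with ⟨rfl, rfl⟩ | ⟨rfl, rfl⟩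
    exacts [⟨p, hp0, hgoal.1, Or.inl ⟨hp, hp'⟩⟩, ⟨p, hp0, hgoal.1, Or.inr ⟨hp, hp'⟩⟩]
  exfalso
  simp only [wsum] at hw
  have a1 := h.psum_gap hr1 hp (x := p + r + 1) (by omega) (by omega)
  have b1 := hp.psum_eq (x := k) (by omega) (by omega)
  generalize hE : k + (s + t) = e at hw
  have b2 : (e ≤ p + r + 1 + r' ∧ psum v e = psum v (p + r + 1) + e - (p + r + 1) - 1) ∨
      (p + r + 1 + r' < e ∧
        psum v e ≤ psum v (p + r + 1) + r' + e - (p + r + 1 + r' + 2)) ∨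
        e = p + r + 1 + r' + 1 ∧ psum v e = psum v (p + r + 1) + r' := by
    rcases Nat.lt_or_ge (p + r + 1 + r') e with h3 | h3
    · rcases Nat.lt_or_ge (p + r + 1 + r' + 1) e with h4 | h4
      · right; left
        refine ⟨h3, ?_⟩
        have c1 := h.psum_gap (by omega) hp' (x := p + r + 1 + r' + 2) (by omega) (by omega)
        have c2 := (hb.le_of_le (i := p + r + 1 + r' + 2) (j := e) (by omega)).2
        push_cast at c2
        omega
      · exact Or.inr (Or.inr ⟨by omega, h.psum_gap (by omega) hp' (by omega) (by omega)⟩)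
    · left
      have := hp'.psum_eq (x := e) (by omega) (by omega)
      push_cast at this
      omega
  rcases b2 with ⟨d1, d2⟩ | ⟨d1, d2⟩ | ⟨d1, d2⟩ <;>
  rcases hr with rfl | rfl <;> rcases hr' with rfl | rfl <;> omega

/-- The class of 1^s 0 1^(t-1) has the returns 1 and 1^(s-1) 0. Two more come from the two returns
of the class of 1^t, by removing the first letter 1 and the suffix 1^s 0, which all of them share.
-/
theorem false_of_no_long_long (h : RunForm v 1 s t) (hb : Binary v) (hr : Recur v)
    (h3 : AtMostThree v) (h2 : AtLeastTwo v) (hst : s + 2 ≤ t)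
    (hBB : ∀ i, OneRun v i t → ¬ OneRun v (i + t + 1) t) : False := by
  have hs := h.s_pos
  have ht := h.lt
  obtain ⟨p₀, h₀⟩ := h.exists_long
  have w1 : ∀ p a b, (a = s ∧ b = t ∨ a = t ∧ b = s) → OneRun v p a → OneRun v (p + a + 1) b →
      wsum v (p + 1) (s + t) = s + t - 1 ∧ wsum v (p + 2) (s + t) = s + t - 1 := by
    intro p a b hab hp hq
    have a1 := h.psum_gap (by omega) hp (x := p + a + 1) (by omega) (by omega)
    have a2 := hq.psum_eq (x := p + 1 + (s + t)) (by omega) (by omega)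
    have a3 := hp.psum_eq (x := p + 1) (by omega) (by omega)
    have a4 := hq.psum_eq (x := p + 2 + (s + t)) (by omega) (by omega)
    have a5 := hp.psum_eq (x := p + 2) (by omega) (by omega)
    constructor <;> simp only [wsum] <;> omega
  obtain ⟨x₁, y₁, x₂, y₂, N1, N2, R1, R2, hne⟩ := h2.far hr t (p₀ + 1) (p₀ + 1)
  have hwt : wsum v (p₀ + 1) t = t := by
    have a1 := h₀.psum_eq (x := p₀ + 1) (by omega) (by omega)
    have a2 := h₀.psum_eq (x := p₀ + 1 + t) (by omega) (by omega)
    simp only [wsum]; omega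
  rw [hwt] at R1 R2
  have long : ∀ x y, p₀ + 1 ≤ x → IsRet v t t x y →
      IsRet v (s + t) (s + t - 1) (x + 1) (y - 1 - s) ∧ x + t < y - 1 - s ∧ v x = 1 ∧
      v (x + s) = 1 ∧
      ∃ q, q + s + 2 = y ∧ OneRun v q s ∧ OneRun v (q + s + 1) t := by
    intro x y hx R
    obtain ⟨g1, g2, g3⟩ := h.oneRun_of_isRet hb h₀ hx R
    have hxy := R.1
    have g4 := h.le_of_lt (by omega) g1 (by omega) g2 (by omega)
    obtain ⟨q, hq0, hq1, hq2⟩ := h.prev_short hBB g1 g2 (by omega)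
    have g5 := h.next_short hBB g1
    have g6 : q ≠ x - 1 := by
      rintro rfl
      have := hq2.unique g1
      omega
    have g7 := h.le_of_lt (by omega) g1 (by omega) hq2 (by omega)
    rw [← hq1] at g2
    have g8 : y - 1 - s = q + 1 := by omega
    refine ⟨?_, by omega, g1.2.1 x (by omega) (by omega), g1.2.1 _ (by omega) (by omega), q,
      by omega, hq2, g2⟩
    rw [g8]
    refine ⟨by omega, ?_, (w1 q _ _ (Or.inl ⟨rfl, rfl⟩) hq2 g2).1, ?_⟩
    · have := (w1 _ _ _ (Or.inr ⟨rfl, rfl⟩) g1 g5).2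
      rwa [show x - 1 + 2 = x + 1 by omega] at this
    · intro k hk1 hk2 hw
      obtain ⟨p, hp0, hkp, hp⟩ := h.occ_of_one hb hst hBB h₀ (by omega) hw
      rcases hp with ⟨hp, hp'⟩ | ⟨hp, hp'⟩
      · rcases Nat.lt_or_ge (p + s + 1) x with h' | h'
        · omega
        · exact g3 (p + s + 1) h' (by omega) hp'
      · exact g3 p (by
          rcases Nat.lt_or_ge p x with h | h
          · omega
          · exact h) (by omega) hp
  obtain ⟨L1, l1, a1, a1', q₁, e1, s1, t1⟩ := long x₁ y₁ N1 R1
  obtain ⟨L2, l2, a2, a2', q₂, e2, s2, t2⟩ := long x₂ y₂ N2 R2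
  have W := w1 q₁ _ _ (Or.inl ⟨rfl, rfl⟩) s1 t1
  have r3 := isRet_one W.1 W.2
  have r4 : IsRet v (s + t) (s + t - 1) (q₁ + 2) (q₁ + s + 1 + 1) := by
    refine ⟨by omega, W.2, (w1 _ _ _ (Or.inr ⟨rfl, rfl⟩) t1 (h.next_short hBB t1)).1, ?_⟩
    intro k hk1 hk2 hw
    obtain ⟨p, hp0, hkp, hp⟩ := h.occ_of_one hb hst hBB h₀ (by omega) hw
    rcases hp with ⟨hp, -⟩ | ⟨hp, -⟩
    · have := h.le_of_lt hs s1 hs hp (by omega)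
      omega
    · have := h.le_of_lt hs s1 (by omega) hp (by omega)
      omega
  have z1 : v (q₁ + s + 1) = 0 := s1.2.2
  have o1 : v (q₁ + 1) = 1 := s1.2.1 _ (by omega) (by omega)
  have long_ne : ∀ x y, x + t < y - 1 - s → v (x + s) = 1 →
      ¬ SameSeg v (x + 1) (y - 1 - s) (q₁ + 2) (q₁ + s + 1 + 1) := by
    intro x y hlen hx hS
    have e := hS.2 (s - 1) (by have := hS.1; omega)
    rw [show x + 1 + (s - 1) = x + s by omega, hx, show q₁ + 2 + (s - 1) = q₁ + s + 1 by omega,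
      z1] at e
    omega
  refine h3 _ _ _ _ _ _ _ _ _ _ r3 r4 L1 L2 ?_ ?_ ?_ ?_ ?_ ?_
  · intro hS
    have e := hS.2 (s - 1) (by have := hS.1; omega)
    have l := hS.1
    rw [show q₁ + 1 + (s - 1) = q₁ + 1 by omega, o1, show q₁ + 2 + (s - 1) = q₁ + s + 1 by omega,
      z1] at e
    omega
  · exact not_sameSeg_of_length (by omega)
  · exact not_sameSeg_of_length (by omega)
  · exact fun H => long_ne x₁ y₁ l1 a1' H.symm
  · exact fun H => long_ne x₂ y₂ l2 a2' H.symm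
  · intro hS
    apply hne
    have hl := hS.1
    refine ⟨by omega, fun k hk => ?_⟩
    rcases Nat.eq_zero_or_pos k with rfl | hk0
    · simp [a1, a2]
    rcases Nat.lt_or_ge k (y₁ - 1 - s - x₁) with hk' | hk'
    · have := hS.2 (k - 1) (by omega)
      rwa [show x₁ + 1 + (k - 1) = x₁ + k by omega, show x₂ + 1 + (k - 1) = x₂ + k by omega]
        at this
    · have key : ∀ m, 0 < m → m < s + 2 → v (q₁ + m) = v (q₂ + m) := by
        intro m hm0 hm
        rcases Nat.lt_or_ge s m with h' | h'
        · have : m = s + 1 := by omega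
          rw [this, ← add_assoc, ← add_assoc, s1.2.2, s2.2.2]
        · rw [s1.2.1 _ (by omega) (by omega), s2.2.1 _ (by omega) (by omega)]
      have := key (x₁ + k - q₁) (by omega) (by omega)
      rw [show q₁ + (x₁ + k - q₁) = x₁ + k by omega,
        show q₂ + (x₁ + k - q₁) = x₂ + k by omega] at this
      exact this

end RunForm
end

section
variable {v : ℕ → ℤ} {f s t : ℕ}
namespace RunForm

theorem next_long (h : RunForm v 1 s t) (hAA : ∀ i, OneRun v i s → ¬ OneRun v (i + s + 1) s)
    {i : ℕ} (hi : OneRun v i s) : OneRun v (i + s + 1) t :=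
  (h.next h.s_pos hi).resolve_left (hAA i hi)

theorem prev_long (h : RunForm v 1 s t) (hAA : ∀ i, OneRun v i s → ¬ OneRun v (i + s + 1) s)
    {p₀ i : ℕ} (h₀ : OneRun v p₀ s) (hi : OneRun v i s) (hlt : p₀ < i) :
    ∃ p, p₀ ≤ p ∧ p + t + 1 = i ∧ OneRun v p t := by
  obtain ⟨p, q, hq, hp, hp0, rfl⟩ := h.prev (Or.inl rfl) h₀ (Or.inl rfl) hi hlt
  rcases hq with rfl | rfl
  · exact absurd hi (hAA p hp)
  · exact ⟨p, hp0, rfl, hp⟩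

-- Such a window has three zeros, hence contains two complete adjacent blocks. Two short ones are
-- excluded and two long ones have too many ones because t ≥ s + 2. For a short-long pair exactly
-- one further 1 is left, after the last zero or before the first.
set_option maxHeartbeats 1000000 in
theorem occ_of_short (h : RunForm v 1 s t) (hb : Binary v) (hst : s + 2 ≤ t)
    (hAA : ∀ i, OneRun v i s → ¬ OneRun v (i + s + 1) s) {p₀ k : ℕ} (h₀ : OneRun v p₀ s)
    (hk : p₀ ≤ k) (hw : wsum v k (s + t + 4) = s + t + 1) :
    ∃ p, p₀ ≤ p ∧ (k = p ∨ k + 1 = p) ∧ ((OneRun v p s ∧ OneRun v (p + s + 1) t) ∨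
      (OneRun v p t ∧ OneRun v (p + t + 1) s)) := by
  have hs := h.s_pos
  have next' : ∀ p r, (r = s ∨ r = t) → OneRun v p r → ∃ r', (r' = s ∨ r' = t) ∧
      OneRun v (p + r + 1) r' ∧ ¬ (r = s ∧ r' = s) := by
    intro p r hr hp
    rcases h.next (by omega) hp with h' | h'
    · refine ⟨s, Or.inl rfl, h', ?_⟩
      rintro ⟨rfl, -⟩
      exact hAA p hp h'
    · exact ⟨t, Or.inr rfl, h', by omega⟩
  obtain ⟨p, r, hr, hp, hp0, h1, h2⟩ := h.cover (Or.inl rfl) h₀ hk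
  obtain ⟨r', hr', hp', hc⟩ := next' p r hr hp
  obtain ⟨r'', hr'', hp'', hc'⟩ := next' _ r' hr' hp'
  by_cases hg : k = p ∧ ((r = s ∧ r' = t) ∨ (r = t ∧ r' = s))
  · rcases hg.2 with ⟨rfl, rfl⟩ | ⟨rfl, rfl⟩
    exacts [⟨p, hp0, Or.inl hg.1, Or.inl ⟨hp, hp'⟩⟩, ⟨p, hp0, Or.inl hg.1, Or.inr ⟨hp, hp'⟩⟩]
  by_cases hg' : k + 1 = p + r + 1 ∧ ((r' = s ∧ r'' = t) ∨ (r' = t ∧ r'' = s))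
  · rcases hg'.2 with ⟨rfl, rfl⟩ | ⟨rfl, rfl⟩
    exacts [⟨_, by omega, Or.inr hg'.1, Or.inl ⟨hp', hp''⟩⟩,
      ⟨_, by omega, Or.inr hg'.1, Or.inr ⟨hp', hp''⟩⟩]
  exfalso
  simp only [wsum] at hw
  have a1 := h.psum_gap (by omega) hp (x := p + r + 1) (by omega) (by omega)
  have a2 := h.psum_gap (by omega) hp' (x := p + r + 1 + r' + 1) (by omega) (by omega)
  have a3 := hp''.psum_eq (x := p + r + 1 + r' + 1 + r'' + 1) (by omega) (by omega)
  push_cast at a3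
  have b1 : (k = p ∧ psum v k = psum v p) ∨ (p < k ∧ psum v k = psum v p + k - p - 1) := by
    rcases Nat.eq_or_lt_of_le h1 with rfl | h1
    · exact Or.inl ⟨rfl, rfl⟩
    · exact Or.inr ⟨h1, hp.psum_eq h1 (by omega)⟩
  generalize hE : k + (s + t + 4) = e at hw
  have b2 : (e ≤ p + r + 1 + r' + 1 ∧ psum v e = psum v (p + r + 1) + e - (p + r + 1) - 1) ∨
      (p + r + 1 + r' + 1 < e ∧ e ≤ p + r + 1 + r' + 1 + r'' + 1 ∧
        psum v e = psum v (p + r + 1 + r' + 1) + e - (p + r + 1 + r' + 1) - 1) ∨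
      (p + r + 1 + r' + 1 + r'' + 1 < e ∧
        psum v (p + r + 1 + r' + 1 + r'' + 1) ≤ psum v e) := by
    rcases Nat.lt_or_ge (p + r + 1 + r' + 1) e with h3 | h3
    · rcases Nat.lt_or_ge (p + r + 1 + r' + 1 + r'' + 1) e with h4 | h4
      · exact Or.inr (Or.inr ⟨h4, (hb.le_of_le h4.le).1⟩)
      · have := hp''.psum_eq (x := e) (by omega) (by omega)
        push_cast at this
        exact Or.inr (Or.inl ⟨h3, h4, by omega⟩)
    · have := hp'.psum_eq (x := e) (by omega) (by omega)
      push_cast at this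
      exact Or.inl ⟨h3, by omega⟩
  clear h hAA next' hp hp' hp'' h₀ hb
  rcases b1 with ⟨c1, c2⟩ | ⟨c1, c2⟩ <;>
  rcases b2 with ⟨d1, d2⟩ | ⟨d1, d2, d3⟩ | ⟨d1, d2⟩ <;>
  rcases hr with rfl | rfl <;> rcases hr' with rfl | rfl <;> rcases hr'' with rfl | rfl <;> omega

/-- Returns to the class of a short block of ones between two zeros. -/
theorem oneRun_short_of_isRet (h : RunForm v 1 s t) {i j p₀ : ℕ}
    (h₀ : OneRun v p₀ s) (hi : p₀ ≤ i) (hij : IsRet v (s + 2) s i j) :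
    OneRun v i s ∧ OneRun v j s ∧ ∀ k, i < k → k < j → ¬ OneRun v k s := by
  have hs := h.s_pos
  have ht := h.lt
  have key : ∀ i, p₀ ≤ i → wsum v i (s + 2) = s → OneRun v i s := by
    intro k hk hw
    obtain ⟨p, r, hr, hp, hp0, h1, h2⟩ := h.cover (Or.inl rfl) h₀ hk
    obtain ⟨r', hr', hp'⟩ : ∃ r', (r' = s ∨ r' = t) ∧ OneRun v (p + r + 1) r' := by
      rcases h.next (by omega) hp with h' | h'
      exacts [⟨s, Or.inl rfl, h'⟩, ⟨t, Or.inr rfl, h'⟩]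
    by_cases hg : k = p ∧ r = s
    · rw [hg.1, ← hg.2]; exact hp
    exfalso
    simp only [wsum] at hw
    have a1 := h.psum_gap (by omega) hp (x := p + r + 1) (by omega) (by omega)
    have b2 : (k + (s + 2) ≤ p + r + 1 ∧
        psum v (k + (s + 2)) = psum v p + (k + (s + 2)) - p - 1) ∨
        (p + r + 1 < k + (s + 2) ∧ k + (s + 2) ≤ p + r + 1 + r' + 1 ∧
        psum v (k + (s + 2)) = psum v (p + r + 1) + (k + (s + 2)) - (p + r + 1) - 1) := by
      rcases Nat.lt_or_ge (p + r + 1) (k + (s + 2)) with h3 | h3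
      · have := hp'.psum_eq (x := k + (s + 2)) (by omega) (by omega)
        push_cast at this
        exact Or.inr ⟨h3, by omega, by omega⟩
      · have := hp.psum_eq (x := k + (s + 2)) (by omega) (by omega)
        push_cast at this
        exact Or.inl ⟨h3, by omega⟩
    rcases Nat.eq_or_lt_of_le h1 with rfl | h1
    · omega
    · have := hp.psum_eq h1 (by omega)
      omega
  obtain ⟨h1, h2, h3, h4⟩ := hij
  refine ⟨key i hi h2, key j (by omega) h3, fun k hk1 hk2 hk => ?_⟩
  apply h4 k hk1 hk2
  have a1 := h.psum_gap hs hk (x := k + (s + 2)) (by omega) (by omega)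
  simp only [wsum]; omega

/-- The class of 0 1^s 0 1^t 0 1 has the returns 1 and 0 1^(t-1). Two more come from the two returns
of the class of 0 1^s 0, by removing their common suffix 1 0 1^t: a long block precedes every short
one met later. -/
theorem false_of_no_short_short (h : RunForm v 1 s t) (hb : Binary v) (hr : Recur v)
    (h3 : AtMostThree v) (h2 : AtLeastTwo v) (hst : s + 2 ≤ t)
    (hAA : ∀ i, OneRun v i s → ¬ OneRun v (i + s + 1) s) : False := by
  have hs := h.s_pos
  have ht := h.lt
  obtain ⟨p₀, h₀⟩ := h.exists_short
  have w1 : ∀ k p a b, k + 1 = p → v k = 1 → (a = s ∧ b = t ∨ a = t ∧ b = s) → OneRun v p a →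
      OneRun v (p + a + 1) b → wsum v k (s + t + 4) = s + t + 1 := by
    rintro k _ a b rfl hk hab hp hq
    have a1 := h.psum_gap (by omega) hp (x := k + 1 + a + 1) (by omega) (by omega)
    have a2 := h.psum_gap (by omega) hq (x := k + (s + t + 4)) (by omega) (by omega)
    have a3 := psum_succ (v := v) k
    simp only [wsum]; omega
  have w0 : ∀ p a b, (a = s ∧ b = t ∨ a = t ∧ b = s) → OneRun v p a →
      OneRun v (p + a + 1) b → wsum v p (s + t + 4) = s + t + 1 := by
    intro p a b hab hp hq
    have a1 := h.psum_gap (by omega) hp (x := p + a + 1) (by omega) (by omega)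
    have a2 := h.psum_gap (by omega) hq (x := p + a + 1 + b + 2) (by omega) (by omega)
    have a3 := psum_succ (v := v) (p + a + 1 + b + 2)
    rw [show p + a + 1 + b + 2 = p + a + 1 + b + 1 + 1 by omega, (h.zeros (by omega) hq).2,
      show p + a + 1 + b + 1 + 1 + 1 = p + (s + t + 4) by omega] at a3
    rw [show p + a + 1 + b + 2 = p + a + 1 + b + 1 + 1 by omega] at a2
    simp only [wsum]; omega
  obtain ⟨x₁, y₁, x₂, y₂, N1, N2, R1, R2, hne⟩ := h2.far hr (s + 2) p₀ p₀
  have hwt : wsum v p₀ (s + 2) = s := by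
    have a1 := h.psum_gap hs h₀ (x := p₀ + (s + 2)) (by omega) (by omega)
    simp only [wsum]; omega
  rw [hwt] at R1 R2
  have long : ∀ x y, p₀ ≤ x → IsRet v (s + 2) s x y →
      IsRet v (s + t + 4) (s + t + 1) x (y - t - 2) ∧ x + s + t + 1 < y ∧ v x = 0 ∧
      v (x + s + 1) = 0 ∧ OneRun v y s ∧
      ∃ q, q + t + 1 = y ∧ OneRun v q t ∧ v (q - 1) = 1 ∧ x < q := by
    intro x y hx R
    obtain ⟨g1, g2, g3⟩ := h.oneRun_short_of_isRet h₀ hx R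
    have hxy := R.1
    obtain ⟨q, hq0, hq1, hq2⟩ := h.prev_long hAA g1 g2 (by omega)
    have g5 := h.next_long hAA g1
    have g6 : q ≠ x := by
      rintro rfl
      have := hq2.unique g1
      omega
    have g7 := h.le_of_lt (by omega) g1 (by omega) hq2 (by omega)
    obtain ⟨o, b, hb', ho, ho0, ho1⟩ := h.prev (Or.inl rfl) g1 (Or.inr rfl) hq2 (by omega)
    have g9 : v (q - 1) = 1 := ho.2.1 _ (by omega) (by omega)
    have g10 := g2
    rw [← hq1] at g2
    have g8 : y - t - 2 = q - 1 := by omega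
    refine ⟨?_, by omega, g1.1, g1.2.2, g10, q, by omega, hq2, g9, by omega⟩
    rw [g8]
    refine ⟨by omega, w0 _ _ _ (Or.inl ⟨rfl, rfl⟩) g1 g5,
      w1 _ q _ _ (by omega) g9 (Or.inr ⟨rfl, rfl⟩) hq2 g2, ?_⟩
    intro k hk1 hk2 hw
    obtain ⟨p, hp0, hkp, hp⟩ := h.occ_of_short hb hst hAA h₀ (by omega) hw
    rcases hp with ⟨hp, hp'⟩ | ⟨hp, hp'⟩
    · exact g3 p (by omega) (by omega) hp
    · exact g3 (p + t + 1) (by omega) (by omega) hp'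
  obtain ⟨L1, l1, a1, a1', Y1, q₁, e1, t1, m1, xq1⟩ := long x₁ y₁ N1 R1
  obtain ⟨L2, l2, a2, a2', Y2, q₂, e2, t2, m2, xq2⟩ := long x₂ y₂ N2 R2
  subst e1
  subst e2
  have r3 : IsRet v (s + t + 4) (s + t + 1) (q₁ - 1) (q₁ - 1 + 1) := by
    refine isRet_one (w1 _ q₁ _ _ (by omega) m1 (Or.inr ⟨rfl, rfl⟩) t1 Y1) ?_
    rw [show q₁ - 1 + 1 = q₁ by omega]
    exact w0 _ _ _ (Or.inr ⟨rfl, rfl⟩) t1 Y1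
  have r4 : IsRet v (s + t + 4) (s + t + 1) q₁ (q₁ + t) := by
    refine ⟨by omega, w0 _ _ _ (Or.inr ⟨rfl, rfl⟩) t1 Y1,
      w1 _ (q₁ + t + 1) _ _ rfl (t1.2.1 _ (by omega) le_rfl) (Or.inl ⟨rfl, rfl⟩) Y1
        (h.next_long hAA Y1), ?_⟩
    intro k hk1 hk2 hw
    obtain ⟨p, hp0, hkp, hp⟩ := h.occ_of_short hb hst hAA h₀ (by omega) hw
    rcases hp with ⟨hp, -⟩ | ⟨hp, -⟩
    · have := h.le_of_lt (by omega) t1 hs hp (by omega)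
      omega
    · have := h.le_of_lt (by omega) t1 (by omega) hp (by omega)
      omega
  have long_ne : ∀ x z, v (x + s + 1) = 0 → ¬ SameSeg v x z q₁ (q₁ + t) := by
    intro x z hx hS
    have e := hS.2 (s + 1) (by have := hS.1; omega)
    rw [← add_assoc, hx, t1.2.1 _ (by omega) (by omega)] at e
    omega
  refine h3 _ _ _ _ _ _ _ _ _ _ r3 r4 L1 L2 ?_ ?_ ?_ ?_ ?_ ?_
  · exact not_sameSeg_of_ne 0 (by omega) (by simp [m1, t1.1])
  · exact not_sameSeg_of_ne 0 (by omega) (by simp [m1, a1])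
  · exact not_sameSeg_of_ne 0 (by omega) (by simp [m1, a2])
  · exact fun H => long_ne x₁ _ a1' H.symm
  · exact fun H => long_ne x₂ _ a2' H.symm
  · intro hS
    apply hne
    have hl := hS.1
    refine ⟨by omega, fun k hk => ?_⟩
    rcases Nat.lt_or_ge k (q₁ + t + 1 - t - 2 - x₁) with hk' | hk'
    · exact hS.2 k hk'
    · have key : ∀ m, m < t + 2 → v (q₁ - 1 + m) = v (q₂ - 1 + m) := by
        intro m hm
        rcases Nat.eq_zero_or_pos m with rfl | hm0
        · simp [m1, m2]
        rcases Nat.lt_or_ge 1 m with h' | h'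
        · rw [t1.2.1 _ (by omega) (by omega), t2.2.1 _ (by omega) (by omega)]
        · rw [show q₁ - 1 + m = q₁ by omega, show q₂ - 1 + m = q₂ by omega, t1.1, t2.1]
      have := key (x₁ + k - (q₁ - 1)) (by omega)
      rwa [show q₁ - 1 + (x₁ + k - (q₁ - 1)) = x₁ + k by omega,
        show q₂ - 1 + (x₁ + k - (q₁ - 1)) = x₂ + k by omega] at this

/-- A recurrent binary word all of whose blocks of zeros have the same length `f` and whose blocks
of ones have two lengths `s < t` violates the bounds on the number of returns, unless `f = 1` and
`t = s + 1`. -/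
theorem elim (h : RunForm v f s t) (hb : Binary v) (hr : Recur v) (h3 : AtMostThree v)
    (h2 : AtLeastTwo v) (hst : 2 ≤ f ∨ s + 2 ≤ t) : False := by
  by_cases hf : 2 ≤ f
  · by_cases hBB : ∃ i, OneRun v i t ∧ OneRun v (i + t + f) t
    · obtain ⟨i, hi, hi'⟩ := hBB
      exact h.false_of_two_le_of_long_long hr h3 hf hi hi'
    · exact h.false_of_two_le hb hr h3 h2 hf fun i hi hi' => hBB ⟨i, hi, hi'⟩
  · have := h.f_pos
    obtain rfl : f = 1 := by omega
    have hst' : s + 2 ≤ t := by omega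
    by_cases hBB : ∃ i, OneRun v i t ∧ OneRun v (i + t + 1) t
    · by_cases hAA : ∃ i, OneRun v i s ∧ OneRun v (i + s + 1) s
      · obtain ⟨i, hi, hi'⟩ := hAA
        obtain ⟨j, hj, hj'⟩ := hBB
        exact h.false_of_short_short_of_long_long hb hr h3 hst' hi hi' hj hj'
      · exact h.false_of_no_short_short hb hr h3 h2 hst' fun i hi hi' => hAA ⟨i, hi, hi'⟩
    · exact h.false_of_no_long_long hb hr h3 h2 hst' fun i hi hi' => hBB ⟨i, hi, hi'⟩

end RunForm
end

/-! ### Shortest imbalances and run lengths. -/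

section
variable {v : ℕ → ℤ}

/-- `n` is the least length of two windows whose sums differ by two, and the sums of all windows of
length `n` lie between `c` and `c + 2`. -/
structure MinUnbalanced (v : ℕ → ℤ) (n : ℕ) (c : ℤ) : Prop where
  bal : ∀ q < n, ∀ i j, wsum v i q ≤ wsum v j q + 1
  lo : ∃ a, wsum v a n = c
  hi : ∃ b, wsum v b n = c + 2
  range : ∀ i, c ≤ wsum v i n ∧ wsum v i n ≤ c + 2

/-- At the least unbalanced length, deleting the last letter leaves balanced windows, so no two sums
differ by more than two. -/
theorem exists_minUnbalanced (hb : Binary v) (h : ¬ Balanced v) : ∃ n c, MinUnbalanced v n c := by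
  classical
  have hex : ∃ n, ∃ i j, wsum v j n + 1 < wsum v i n := by
    by_contra hne
    push Not at hne
    exact h fun n i j => hne n i j
  obtain ⟨i, j, hij⟩ := Nat.find_spec hex
  have hmin : ∀ q < Nat.find hex, ∀ i j, wsum v i q ≤ wsum v j q + 1 := by
    intro q hq i j
    by_contra hlt
    exact Nat.find_min hex hq ⟨i, j, by omega⟩
  generalize Nat.find hex = n at hij hmin
  cases n with
  | zero => simp [wsum_zero] at hij
  | succ m =>
    have two : ∀ i j, wsum v i (m + 1) ≤ wsum v j (m + 1) + 2 := by
      intro i j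
      have := hmin m (by omega) i j
      rw [wsum_succ, wsum_succ]
      rcases hb (i + m) with h | h <;> rcases hb (j + m) with h' | h' <;> omega
    have e : wsum v i (m + 1) = wsum v j (m + 1) + 2 := by
      have := two i j
      omega
    refine ⟨m + 1, wsum v j (m + 1), hmin, ⟨j, rfl⟩, ⟨i, e⟩, fun k => ⟨?_, two k j⟩⟩
    have := two i k
    omega

theorem MinUnbalanced.compl {n : ℕ} {c : ℤ} (h : MinUnbalanced v n c) :
    MinUnbalanced (compl v) n (n - c - 2) := by
  refine ⟨fun q hq i j => ?_, ?_, ?_, fun i => ?_⟩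
  · have := h.bal q hq j i
    rw [wsum_compl, wsum_compl]; omega
  · obtain ⟨b, hb⟩ := h.hi
    exact ⟨b, by rw [wsum_compl]; omega⟩
  · obtain ⟨b, hb⟩ := h.lo
    exact ⟨b, by rw [wsum_compl]; omega⟩
  · have := h.range i
    rw [wsum_compl]; omega

theorem exists_last {p : ℕ → Prop} {a h : ℕ} (hah : a < h) (ha : p a) :
    ∃ l, a ≤ l ∧ l < h ∧ p l ∧ ∀ k, l < k → k < h → ¬ p k := by
  classical
  refine ⟨Nat.findGreatest p (h - 1), Nat.le_findGreatest (by omega) ha, ?_, ?_, ?_⟩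
  · have := Nat.findGreatest_le (P := p) (h - 1)
    omega
  · exact Nat.findGreatest_spec (P := p) (m := a) (by omega) ha
  · intro k hk hk'
    exact Nat.findGreatest_is_greatest hk (by omega)

/-- Without a one-letter return `1` to the middle class, the light windows consist of zeros. -/
theorem MinUnbalanced.eq_zero {n : ℕ} {c : ℤ} (h : MinUnbalanced v n c) (hb : Binary v)
    (hr : Recur v) (hst : ∀ i, wsum v i n = c + 1 → v i = 1 → v (i + n) ≠ 1) : c = 0 := by
  classical
  obtain ⟨a, ha⟩ := h.lo
  have hex : ∃ b, a < b ∧ wsum v b n = c + 2 := by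
    obtain ⟨b, hb⟩ := h.hi
    obtain ⟨b', h1, h2⟩ := hr.exists_wsum n b (a + 1)
    exact ⟨b', h1, h2.trans hb⟩
  obtain ⟨hab, hH⟩ := Nat.find_spec hex
  have hmin : ∀ k, a < k → k < Nat.find hex → wsum v k n ≠ c + 2 := fun k h1 h2 h3 =>
    Nat.find_min hex h2 ⟨h1, h3⟩
  generalize Nat.find hex = b at hab hH hmin
  obtain ⟨l, hal, hlb, hl, hl'⟩ := exists_last (p := fun k => wsum v k n = c) hab ha
  have mid : ∀ k, l < k → k < b → wsum v k n = c + 1 := by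
    intro k h1 h2
    have e1 := hl' k h1 h2
    have e2 := hmin k (by omega) h2
    have e3 := h.range k
    omega
  -- Between the last light window and the first heavy one all windows are in the middle class.
  -- Losing a 1 there would require gaining a 1, which is the missing return.
  have zero : ∀ k, l ≤ k → k < b → v k = 0 := by
    intro k h1 h2
    have e := wsum_shift (v := v) k n
    rcases hb k with hk | hk
    · exact hk
    exfalso
    rcases Nat.eq_or_lt_of_le h1 with rfl | h1
    · have := h.range (l + 1)
      rcases hb (l + n) with hk' | hk'
      · omega
      · rcases Nat.eq_or_lt_of_le (show l + 1 ≤ b from h2) with h4 | h4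
        · rw [h4] at e; omega
        · have := mid (l + 1) (by omega) h4
          omega
    · have e1 := mid k h1 h2
      rcases Nat.eq_or_lt_of_le (show k + 1 ≤ b from h2) with h4 | h4
      · rw [h4] at e
        rcases hb (k + n) with hk' | hk' <;> omega
      · have e2 := mid (k + 1) (by omega) h4
        exact hst k e1 hk (by omega)
  have hz := psum_zeros hlb.le zero
  -- Since [l, b) has only zeros, passing from the window at l to that at b adds two ones in [l+n,
  -- b+n). Compared with [l, b) this would be a shorter imbalance if b - l < n.
  have key : n ≤ b - l := by
    by_contra hlt
    have := h.bal (b - l) (by omega) (l + n) l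
    simp only [wsum] at this hl hH
    rw [show l + n + (b - l) = b + n by omega, show l + (b - l) = b by omega] at this
    omega
  have := psum_zeros (v := v) (i := l) (j := l + n) (by omega) (fun k h1 h2 => zero k h1 (by omega))
  simp only [wsum] at hl
  omega

theorem MinUnbalanced.two_le {n : ℕ} {c : ℤ} (h : MinUnbalanced v n c) (hb : Binary v) : 2 ≤ n := by
  obtain ⟨a, ha⟩ := h.lo
  obtain ⟨b, hb'⟩ := h.hi
  have h1 := hb.le_of_le (show a ≤ a + n by omega)
  have h2 := hb.le_of_le (show b ≤ b + n by omega)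
  simp only [wsum] at ha hb'
  push_cast at h1 h2
  omega

theorem oneRun_compl {i r : ℕ} : OneRun (compl v) i r ↔
    v i = 1 ∧ (∀ k, i < k → k ≤ i + r → v k = 0) ∧ v (i + r + 1) = 1 := by
  have e0 : ∀ x : ℤ, 1 - x = 0 ↔ x = 1 := fun x => by omega
  have e1 : ∀ x : ℤ, 1 - x = 1 ↔ x = 0 := fun x => by omega
  simp only [OneRun, compl, e0, e1]

theorem exists_oneRun (hb : Binary v) (hr : Recur v) {i : ℕ} (h0 : v i = 0) (h1 : v (i + 1) = 1) :
    ∃ r, 1 ≤ r ∧ OneRun v i r := by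
  classical
  have hex : ∃ m, v (i + m + 1) = 0 := by
    obtain ⟨j, hj, h⟩ := hr i 1 (i + 1)
    refine ⟨j - i - 1, ?_⟩
    rw [show i + (j - i - 1) + 1 = j by omega]
    simpa [h0] using h 0 (by omega)
  refine ⟨Nat.find hex, ?_, h0, fun k hk hk' => ?_, Nat.find_spec hex⟩
  · by_contra hlt
    have := Nat.find_spec hex
    rw [show Nat.find hex = 0 by omega, add_zero] at this
    omega
  · have := Nat.find_min hex (m := k - i - 1) (by omega)
    rw [show i + (k - i - 1) + 1 = k by omega] at this
    exact (hb k).resolve_left this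

theorem exists_zeroRun (hb : Binary v) (hr : Recur v) {i : ℕ} (h0 : v i = 1)
    (h1 : v (i + 1) = 0) : ∃ r, 1 ≤ r ∧ OneRun (compl v) i r :=
  exists_oneRun hb.compl hr.compl (by simp [compl, h0]) (by simp [compl, h1])

theorem RunForm.mk' (hb : Binary v) (hr : Recur v) {f s t : ℕ}
    (hz : ∀ i r, 1 ≤ r → OneRun (compl v) i r → r = f)
    (ho : ∀ i r, 1 ≤ r → OneRun v i r → r = s ∨ r = t)
    (hs : ∃ i, OneRun v i s) (ht : ∃ i, OneRun v i t) (hs1 : 1 ≤ s) (hst : s < t) :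
    RunForm v f s t := by
  have hz' : ∀ i, v i = 1 → v (i + 1) = 0 → OneRun (compl v) i f ∧ 1 ≤ f := by
    intro i h0 h1
    obtain ⟨r, hr1, hr'⟩ := exists_zeroRun hb hr h0 h1
    have := hz i r hr1 hr'
    exact ⟨this ▸ hr', this ▸ hr1⟩
  refine ⟨fun i h0 h1 => ?_, fun i h0 h1 => ?_, hs, ht, ?_, hs1, hst⟩
  · obtain ⟨-, h2⟩ := oneRun_compl.1 (hz' i h0 h1).1
    exact h2
  · obtain ⟨r, hr1, hr'⟩ := exists_oneRun hb hr h0 h1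
    rcases ho i r hr1 hr' with rfl | rfl
    exacts [Or.inl hr', Or.inr hr']
  · obtain ⟨i, hi⟩ := hs
    exact (hz' (i + s) (hi.2.1 _ (by omega) le_rfl) hi.2.2).2

/-- Returns to the class of 01 go from one change of letter to the next, so they record the run
lengths; with at most three returns there are at most three (letter, run length) pairs. -/
theorem OneRun.isRet_two {i r : ℕ} (h : OneRun v i r) (hr : 1 ≤ r) : IsRet v 2 1 i (i + r) := by
  have two : ∀ i, wsum v i 2 = v i + v (i + 1) := fun i => by
    rw [show 2 = 1 + 1 by rfl, wsum_succ, wsum_one]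
  refine ⟨by omega, ?_, ?_, fun k hk hk' => ?_⟩
  · rw [two, h.1, h.2.1 (i + 1) (by omega) (by omega)]; rfl
  · rw [two, h.2.1 (i + r) (by omega) le_rfl, h.2.2]; rfl
  · rw [two, h.2.1 k hk (by omega), h.2.1 (k + 1) (by omega) (by omega)]; decide

theorem OneRun.isRet_two_compl {i r : ℕ} (h : OneRun (compl v) i r) (hr : 1 ≤ r) :
    IsRet v 2 1 i (i + r) := by
  have := h.isRet_two hr
  rw [isRet_compl] at this
  simpa using this

/-- Words with constant run lengths have a class with a single return. -/
theorem AtLeastTwo.not_const_runs (h2 : AtLeastTwo v) (hb : Binary v) (hr : Recur v) {f s p : ℕ}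
    (hs : 1 ≤ s)
    (hz : ∀ i r, 1 ≤ r → OneRun (AbelianReturns.compl v) i r → r = f)
    (ho : ∀ i r, 1 ≤ r → OneRun v i r → r = s) (hp : OneRun v p s) : False := by
  obtain ⟨x₁, y₁, x₂, y₂, N1, N2, R1, R2, hne⟩ := h2.far hr s (p + 1) (p + 1)
  have hw : wsum v (p + 1) s = s := by
    have a1 := hp.psum_eq (x := p + 1) (by omega) (by omega)
    have a2 := hp.psum_eq (x := p + 1 + s) (by omega) (by omega)
    simp only [wsum]; omega
  rw [hw] at R1 R2
  have run : ∀ x, p < x → wsum v x s = s → OneRun v (x - 1) s := by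
    intro x hx hwx
    have ones : ∀ k, x ≤ k → k < x + s → v k = 1 := fun k h1 h2 =>
      hb.ones_of_psum (i := x) (j := x + s) (by simp only [wsum] at hwx; push_cast; omega) h1 h2
    obtain ⟨l, hl1, hl2, hl3, hl4⟩ := exists_last (p := fun k => v k = 0) hx hp.1
    have hl5 : ∀ k, l < k → k < x + s → v k = 1 := fun k h1 h2 => by
      rcases Nat.lt_or_ge k x with h | h
      · exact (hb k).resolve_left (hl4 k h1 h)
      · exact ones k h h2
    obtain ⟨r, hr1, hr'⟩ := exists_oneRun hb hr hl3 (hl5 (l + 1) (by omega) (by omega))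
    obtain rfl := ho _ _ hr1 hr'
    rcases Nat.lt_or_ge (l + 1) x with h | h
    · have := hl5 (l + r + 1) (by omega) (by omega)
      have := hr'.2.2
      omega
    · rwa [show x - 1 = l by omega]
  have main : ∀ x y, p < x → IsRet v s s x y → OneRun v (x - 1) s ∧
      OneRun (AbelianReturns.compl v) (x - 1 + s) f ∧ y = x + s + f := by
    intro x y hx R
    have g1 := run x hx R.2.1
    have g2 := run y (by have := R.1; omega) R.2.2.1
    obtain ⟨r, hr1, hr'⟩ := exists_zeroRun hb hr (g1.2.1 (x - 1 + s) (by omega) le_rfl) g1.2.2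
    obtain rfl := hz _ _ hr1 hr'
    have g3 := oneRun_compl.1 hr'
    obtain ⟨r', hr1', hr''⟩ := exists_oneRun hb hr (g3.2.1 (x - 1 + s + r) (by omega) le_rfl) g3.2.2
    obtain rfl := ho _ _ hr1' hr''
    refine ⟨g1, hr', ?_⟩
    have hxy := R.1
    rcases lt_trichotomy y (x + r' + r) with h | h | h
    · exfalso
      rcases Nat.lt_or_ge (y - 1) (x - 1 + r' + 1) with h' | h'
      · have := g1.2.1 (y - 1) (by omega) (by omega)
        have := g2.1
        omega
      · have e1 := g3.2.1 y (by omega) (by omega)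
        have e2 := g2.2.1 y (by omega) (by omega)
        omega
    · exact h
    · exfalso
      refine R.2.2.2 (x + r' + r) (by omega) h ?_
      have a1 := hr''.psum_eq (x := x + r' + r) (by omega) (by omega)
      have a2 := hr''.psum_eq (x := x + r' + r + r') (by omega) (by omega)
      simp only [wsum]; push_cast at *; omega
  obtain ⟨a1, b1, c1⟩ := main _ _ N1 R1
  obtain ⟨a2, b2, c2⟩ := main _ _ N2 R2
  rw [oneRun_compl] at b1 b2
  apply hne
  refine ⟨by omega, fun k hk => ?_⟩
  rcases Nat.lt_or_ge k s with h | h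
  · rw [a1.2.1 _ (by omega) (by omega), a2.2.1 _ (by omega) (by omega)]
  · rw [b1.2.1 _ (by omega) (by omega), b2.2.1 _ (by omega) (by omega)]

end

/-! ### The returns force balance. -/

section
variable {v : ℕ → ℤ}

theorem not_sameSeg_oneRun_zeroRun {i r j r' : ℕ} (h : OneRun v i r) (h' : OneRun (compl v) j r')
    (hr : 1 ≤ r) : ¬ SameSeg v i (i + r) j (j + r') :=
  not_sameSeg_of_ne 0 (by omega) (by simp [h.1, (oneRun_compl.1 h').1])

theorem not_sameSeg_add {i r j r' : ℕ} (h : r ≠ r') : ¬ SameSeg v i (i + r) j (j + r') :=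
  not_sameSeg_of_length (by omega)

/-- The zero runs use up one return of the class of 01, so blocks of ones have at most two lengths.
One length contradicts `AtLeastTwo.not_const_runs`; two lengths contradict `RunForm.elim` with f ≥
2. -/
theorem false_of_all_zeroRuns_eq (hb : Binary v) (hr : Recur v) (h3 : AtMostThree v)
    (h2 : AtLeastTwo v) {p r₁ r₀ : ℕ} (hp : OneRun v p r₁) (hr₁ : 1 ≤ r₁) (hr₀ : 2 ≤ r₀)
    (hz : ∀ i r, 1 ≤ r → OneRun (compl v) i r → r = r₀) : False := by
  by_cases ho : ∀ i r, 1 ≤ r → OneRun v i r → r = r₁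
  · exact h2.not_const_runs hb hr hr₁ hz ho hp
  push Not at ho
  obtain ⟨q, r₂, hr₂, hq, hne⟩ := ho
  obtain ⟨u, hu1, hu⟩ := exists_zeroRun hb hr (hp.2.1 (p + r₁) (by omega) le_rfl) hp.2.2
  have ho : ∀ i r, 1 ≤ r → OneRun v i r → r = r₁ ∨ r = r₂ := by
    intro i r hr1 hi
    by_contra hlt
    push Not at hlt
    exact h3 2 1 _ _ _ _ _ _ _ _ (hp.isRet_two hr₁) (hq.isRet_two hr₂) (hi.isRet_two hr1)
      (hu.isRet_two_compl hu1) (not_sameSeg_add hne.symm) (not_sameSeg_add hlt.1.symm)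
      (not_sameSeg_oneRun_zeroRun hp hu hr₁) (not_sameSeg_add hlt.2.symm)
      (not_sameSeg_oneRun_zeroRun hq hu hr₂) (not_sameSeg_oneRun_zeroRun hi hu hr1)
  rcases lt_or_gt_of_ne hne with h | h
  · exact (RunForm.mk' hb hr hz (fun i r a b => (ho i r a b).symm) ⟨q, hq⟩ ⟨p, hp⟩ hr₂ h).elim
      hb hr h3 h2 (Or.inl hr₀)
  · exact (RunForm.mk' hb hr hz ho ⟨p, hp⟩ ⟨q, hq⟩ hr₁ h).elim hb hr h3 h2 (Or.inl hr₀)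

/-- The missing return 1 excludes 101, so zero runs have length at least two, and 11 occurs. If zero
runs have two lengths, only one length is left for runs of ones; the constant length needed is then
that of a run of ones of length at least two, after exchanging letters. -/
theorem MinUnbalanced.false_of_two (h : MinUnbalanced v 2 0) (hb : Binary v) (hr : Recur v)
    (h3 : AtMostThree v) (h2 : AtLeastTwo v)
    (hst : ∀ i, wsum v i 2 = 1 → v i = 1 → v (i + 2) ≠ 1) : False := by
  have two : ∀ i, wsum v i 2 = v i + v (i + 1) := fun i => by
    rw [show 2 = 1 + 1 by rfl, wsum_succ, wsum_one]
  obtain ⟨a, ha⟩ := h.lo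
  obtain ⟨b, hb'⟩ := h.hi
  rw [two] at ha hb'
  have hz2 : ∀ i r, 1 ≤ r → OneRun (AbelianReturns.compl v) i r → 2 ≤ r := by
    intro i r hr1 hi
    by_contra hlt
    obtain rfl : r = 1 := by omega
    rw [oneRun_compl] at hi
    exact hst i (by rw [two, hi.1, hi.2.1 (i + 1) (by omega) (by omega)]; rfl) hi.1 hi.2.2
  have ha0 : v a = 0 := by rcases hb a with h | h <;> rcases hb (a + 1) with h' | h' <;> omega
  have hb1 : v b = 1 ∧ v (b + 1) = 1 := by
    rcases hb b with h | h <;> rcases hb (b + 1) with h' | h' <;> omega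
  -- a run of ones of length at least two
  obtain ⟨p, r₁, hr₁, hp⟩ : ∃ p r, 2 ≤ r ∧ OneRun v p r := by
    obtain ⟨b', hbb, hb''⟩ := hr b 2 (a + 1)
    have e0 : v b' = 1 := by simpa [hb1.1] using hb'' 0 (by omega)
    have e1 : v (b' + 1) = 1 := by simpa [hb1.2] using hb'' 1 (by omega)
    obtain ⟨l, hl1, hl2, hl3, hl4⟩ := exists_last (p := fun k => v k = 0) (show a < b' from hbb) ha0
    have hl5 : ∀ k, l < k → k ≤ b' + 1 → v k = 1 := fun k h1 h2 => by
      rcases Nat.lt_or_ge k b' with h | h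
      · exact (hb k).resolve_left (hl4 k h1 h)
      · rcases Nat.eq_or_lt_of_le h with rfl | h
        · exact e0
        · rwa [show k = b' + 1 by omega]
    obtain ⟨r, hr1, hr'⟩ := exists_oneRun hb hr hl3 (hl5 (l + 1) (by omega) (by omega))
    refine ⟨l, r, ?_, hr'⟩
    by_contra hlt
    have := hl5 (l + r + 1) (by omega) (by omega)
    have := hr'.2.2
    omega
  obtain ⟨r₀, hr₀, hu⟩ := exists_zeroRun hb hr (hp.2.1 (p + r₁) (by omega) le_rfl) hp.2.2
  by_cases hz : ∀ i r, 1 ≤ r → OneRun (AbelianReturns.compl v) i r → r = r₀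
  · exact false_of_all_zeroRuns_eq hb hr h3 h2 hp (by omega) (hz2 _ _ hr₀ hu) hz
  · push Not at hz
    obtain ⟨q, r₂, hr₂, hq, hne⟩ := hz
    have ho : ∀ i r, 1 ≤ r → OneRun v i r → r = r₁ := by
      intro i r hr1 hi
      by_contra hlt
      exact h3 2 1 _ _ _ _ _ _ _ _ (hp.isRet_two (by omega)) (hi.isRet_two hr1)
        (hu.isRet_two_compl hr₀)
        (hq.isRet_two_compl hr₂) (not_sameSeg_add (Ne.symm hlt))
        (not_sameSeg_oneRun_zeroRun hp hu (by omega)) (not_sameSeg_oneRun_zeroRun hp hq (by omega))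
        (not_sameSeg_oneRun_zeroRun hi hu hr1) (not_sameSeg_oneRun_zeroRun hi hq hr1)
        (not_sameSeg_add hne.symm)
    refine false_of_all_zeroRuns_eq hb.compl hr.compl h3.compl h2.compl hu hr₀ hr₁ ?_
    rw [compl_compl]
    exact ho

/-- Windows of length n - 1 contain at most one 1, since one of them is zero. So ones are isolated
and a heavy window is 1 0^(n-2) 1. Zero runs have length n - 2 or at least n, and each length at
least n yields its own return to the class of sum one, besides 01 and 0. Only one such length F
fits, and the complement is excluded by `RunForm.elim` with s = n - 2, t = F. -/
theorem MinUnbalanced.false_of_three_le {n : ℕ} (h : MinUnbalanced v n 0) (hn : 3 ≤ n)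
    (hb : Binary v) (hr : Recur v) (h3 : AtMostThree v) (h2 : AtLeastTwo v)
    (hst : ∀ i, wsum v i n = 1 → v i = 1 → v (i + n) ≠ 1) : False := by
  obtain ⟨a, ha⟩ := h.lo
  obtain ⟨b, hb'⟩ := h.hi
  have za : ∀ k, a ≤ k → k < a + n → v k = 0 := fun k h1 h2 =>
    hb.zeros_of_psum (i := a) (j := a + n) (by simp only [wsum] at ha; omega) h1 h2
  have gap : ∀ i j, i < j → v i = 1 → v j = 1 → n - 1 ≤ j - i := by
    intro i j hij hi hj
    by_contra hlt
    have e := h.bal (n - 1) (by omega) i a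
    have e1 := psum_succ (v := v) i
    have e2 := psum_succ (v := v) j
    have e3 := (hb.le_of_le (show i + 1 ≤ j from hij)).1
    have e4 := (hb.le_of_le (show j + 1 ≤ i + (n - 1) by omega)).1
    have e5 := psum_zeros (v := v) (i := a) (j := a + (n - 1)) (by omega)
      (fun k h1 h2 => za k h1 (by omega))
    simp only [wsum] at e
    omega
  have iso : ∀ i, v i = 1 → v (i + 1) = 0 := by
    intro i hi
    rcases hb (i + 1) with h | h
    · exact h
    · have := gap i (i + 1) (by omega) hi h
      omega
  -- a heavy window, at a positive position
  obtain ⟨b, hb0, hb1⟩ := hr.exists_wsum n b 1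
  rw [hb'] at hb1
  have small : ∀ i, wsum v i (n - 1) ≤ 1 := by
    intro i
    have e := h.bal (n - 1) (by omega) i a
    have e5 := psum_zeros (v := v) (i := a) (j := a + (n - 1)) (by omega)
      (fun k h1 h2 => za k h1 (by omega))
    simp only [wsum] at e ⊢
    omega
  have hbe : v (b + (n - 1)) = 1 ∧ wsum v b (n - 1) = 1 := by
    have e := wsum_succ (v := v) b (n - 1)
    rw [show n - 1 + 1 = n by omega, hb1] at e
    have := small b
    rcases hb (b + (n - 1)) with h | h <;> omega
  have hbs : v b = 1 := by
    have e := wsum_add (v := v) b 1 (n - 1)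
    rw [show 1 + (n - 1) = n by omega, hb1, wsum_one] at e
    have := small (b + 1)
    rcases hb b with h | h <;> omega
  have zb : ∀ k, b < k → k < b + (n - 1) → v k = 0 := by
    intro k h1 h2
    rcases hb k with h | h
    · exact h
    · have := gap b k h1 hbs h
      omega
  have runS : OneRun (AbelianReturns.compl v) b (n - 2) := by
    rw [oneRun_compl]
    refine ⟨hbs, fun k h1 h2 => zb k h1 (by omega), ?_⟩
    rw [show b + (n - 2) + 1 = b + (n - 1) by omega]
    exact hbe.1
  -- lengths of runs of zeros
  have len : ∀ i r, 1 ≤ r → OneRun (AbelianReturns.compl v) i r → r = n - 2 ∨ n ≤ r := by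
    intro i r hr1 hi
    rw [oneRun_compl] at hi
    have e1 := gap i (i + r + 1) (by omega) hi.1 hi.2.2
    by_cases hrn : r = n - 1
    -- A gap of n - 1 zeros between two ones would produce the missing one-letter return.
    · exfalso
      refine hst i ?_ hi.1 ?_
      · have e2 := psum_succ (v := v) i
        have e3 := psum_zeros (v := v) (i := i + 1) (j := i + n) (by omega)
          (fun k h1 h2 => hi.2.1 k (by omega) (by omega))
        have := hi.1
        simp only [wsum]; omega
      · rw [show i + n = i + r + 1 by omega]; exact hi.2.2
    · omega
  -- the return of a long run
  have ret : ∀ i r, n ≤ r → OneRun (AbelianReturns.compl v) i r → IsRet v n 1 i (i + (r + 2 - n)) := by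
    intro i r hnr hi
    rw [oneRun_compl] at hi
    have e2 := psum_succ (v := v) i
    have z : ∀ x, i < x → x ≤ i + r + 1 → psum v x = psum v (i + 1) := fun x h1 h2 =>
      psum_zeros h1 (fun k h3 h4 => hi.2.1 k (by omega) (by omega))
    have e3 := psum_succ (v := v) (i + r + 1)
    have hi1 := hi.1
    have hi2 := hi.2.2
    refine ⟨by omega, ?_, ?_, fun k h1 h2 => ?_⟩
    · have := z (i + n) (by omega) (by omega)
      simp only [wsum]; omega
    · have e4 := z (i + (r + 2 - n)) (by omega) (by omega)
      have e5 := z (i + r + 1) (by omega) (by omega)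
      simp only [wsum]
      rw [show i + (r + 2 - n) + n = i + r + 1 + 1 by omega]
      omega
    · have e4 := z k (by omega) (by omega)
      have e5 := z (k + n) (by omega) (by omega)
      simp only [wsum]; omega
  -- the returns `01` and `0`
  have hvb : v (b - 1) = 0 := by
    rcases hb (b - 1) with h | h
    · exact h
    · have := iso (b - 1) h
      rw [show b - 1 + 1 = b by omega] at this
      omega
  have r01 : IsRet v n 1 (b - 1) (b + 1) := by
    have e1 := wsum_shift (v := v) (b - 1) n
    have e2 := wsum_shift (v := v) b n
    rw [show b - 1 + 1 = b by omega, show b - 1 + n = b + (n - 1) by omega] at e1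
    have e3 := iso (b + (n - 1)) hbe.1
    rw [show b + (n - 1) + 1 = b + n by omega] at e3
    refine ⟨by omega, by omega, by omega, fun k h1 h2 => ?_⟩
    obtain rfl : k = b := by omega
    omega
  obtain ⟨i, F, hF, hi⟩ : ∃ i F, n ≤ F ∧ OneRun (AbelianReturns.compl v) i F := by
    obtain ⟨a', haa, hza⟩ := hr a n (b + 1)
    have za' : ∀ k, a' ≤ k → k < a' + n → v k = 0 := fun k h1 h2 => by
      have := hza (k - a') (by omega)
      rw [show a' + (k - a') = k by omega] at this
      rw [this]; exact za _ (by omega) (by omega)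
    obtain ⟨l, hl1, hl2, hl3, hl4⟩ := exists_last (p := fun k => v k = 1) (show b < a' from haa) hbs
    have hl5 : ∀ k, l < k → k < a' + n → v k = 0 := fun k h1 h2 => by
      rcases Nat.lt_or_ge k a' with h | h
      · exact (hb k).resolve_right (hl4 k h1 h)
      · exact za' k h h2
    obtain ⟨r, hr1, hr'⟩ := exists_zeroRun hb hr hl3 (hl5 (l + 1) (by omega) (by omega))
    refine ⟨l, r, ?_, hr'⟩
    by_contra hlt
    have := hl5 (l + r + 1) (by omega) (by omega)
    have := (oneRun_compl.1 hr').2.2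
    omega
  have r0 : IsRet v n 1 (i + (F + 2 - n)) (i + (F + 2 - n) + 1) ∧ v (i + (F + 2 - n)) = 0 := by
    have e0 := (ret i F hF hi).2.2.1
    have e1 := (oneRun_compl.1 hi).2.1 (i + (F + 2 - n)) (by omega) (by omega)
    refine ⟨isRet_one e0 ?_, e1⟩
    have e2 := iso _ (oneRun_compl.1 hi).2.2
    rw [wsum_shift, e0, e1, show i + (F + 2 - n) + n = i + F + 1 + 1 by omega, e2]; rfl
  have uniq : ∀ j r, 1 ≤ r → OneRun (AbelianReturns.compl v) j r → r = n - 2 ∨ r = F := by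
    intro j r hr1 hj
    rcases len j r hr1 hj with h | h
    · exact Or.inl h
    by_contra hne
    push Not at hne
    refine h3 n 1 _ _ _ _ _ _ _ _ r01 r0.1 (ret i F hF hi) (ret j r h hj) ?_ ?_ ?_ ?_ ?_ ?_
    · exact not_sameSeg_of_length (by omega)
    · exact not_sameSeg_of_ne 0 (by omega) (by simp [hvb, (oneRun_compl.1 hi).1])
    · exact not_sameSeg_of_ne 0 (by omega) (by simp [hvb, (oneRun_compl.1 hj).1])
    · exact not_sameSeg_of_length (by omega)
    · exact not_sameSeg_of_length (by omega)
    · exact not_sameSeg_of_length (by omega)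
  refine (RunForm.mk' (f := 1) hb.compl hr.compl ?_ uniq ⟨b, runS⟩ ⟨i, hi⟩ (by omega)
    (by omega)).elim hb.compl hr.compl h3.compl h2.compl (Or.inr (by omega))
  rw [compl_compl]
  intro j r hr1 hj
  by_contra hne
  have e1 := iso (j + 1) (hj.2.1 _ (by omega) (by omega))
  have e2 := hj.2.1 (j + 1 + 1) (by omega) (by omega)
  omega

theorem MinUnbalanced.false_of_no_stay {n : ℕ} {c : ℤ} (h : MinUnbalanced v n c)
    (hb : Binary v) (hr : Recur v) (h3 : AtMostThree v) (h2 : AtLeastTwo v)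
    (hst : ∀ i, wsum v i n = c + 1 → v i = 1 → v (i + n) ≠ 1) : False := by
  obtain rfl := h.eq_zero hb hr hst
  rcases Nat.eq_or_lt_of_le (h.two_le hb) with rfl | hn
  · exact h.false_of_two hb hr h3 h2 (by simpa using hst)
  · exact h.false_of_three_le hn hb hr h3 h2 (by simpa using hst)

/-- A recurrent binary word whose window classes have two or three returns is balanced. -/
theorem balanced_of_returns (hb : Binary v) (hr : Recur v) (h3 : AtMostThree v)
    (h2 : AtLeastTwo v) : Balanced v := by
  by_contra hbal
  obtain ⟨n, c, h⟩ := exists_minUnbalanced hb hbal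
  -- If neither one-letter return is missing from the middle class, the two crossings complete four
  -- returns.
  by_cases h1 : ∀ i, wsum v i n = c + 1 → v i = 1 → v (i + n) ≠ 1
  · exact h.false_of_no_stay hb hr h3 h2 h1
  by_cases h0 : ∀ i, wsum v i n = c + 1 → v i = 0 → v (i + n) ≠ 0
  · refine h.compl.false_of_no_stay hb.compl hr.compl h3.compl h2.compl fun i hi hi1 hi2 => ?_
    rw [wsum_compl] at hi
    simp only [compl] at hi1 hi2
    exact h0 i (by omega) (by omega) (by omega)
  push Not at h0 h1
  obtain ⟨i₀, a0, b0, c0⟩ := h0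
  obtain ⟨i₁, a1, b1, c1⟩ := h1
  obtain ⟨a, ha⟩ := h.lo
  obtain ⟨b, hb'⟩ := h.hi
  exact h3.fourWays hb hr a0 b0 c0 a1 b1 c1 (a := a) (b := b) (by omega) (by omega)

end

/-! ### Balanced words with two returns are not periodic. -/

section
variable {v : ℕ → ℤ}

theorem Balanced.exists_bounds (h : Balanced v) (n : ℕ) :
    ∃ c, ∀ i, c ≤ wsum v i n ∧ wsum v i n ≤ c + 1 := by
  by_cases hex : ∃ i j, wsum v i n < wsum v j n
  · obtain ⟨i, j, hij⟩ := hex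
    refine ⟨wsum v i n, fun k => ⟨?_, h n k i⟩⟩
    have := h n j k
    omega
  · push Not at hex
    exact ⟨wsum v 0 n, fun k => ⟨hex k 0, by have := hex 0 k; omega⟩⟩

theorem wsum_eq_sum (i n : ℕ) : wsum v i n = ∑ k ∈ Finset.range n, v (i + k) := by
  induction n with
  | zero => simp [wsum_zero]
  | succ n ih => rw [wsum_succ, ih, Finset.sum_range_succ]

theorem wsum_period {p : ℕ} (h : ∀ i, v (i + p) = v i) (i : ℕ) : wsum v i p = wsum v 0 p := by
  induction i with
  | zero => rfl
  | succ i ih => rw [wsum_shift, ih, h]; ring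

theorem sum_wsum {p : ℕ} (h : ∀ i, v (i + p) = v i) (n : ℕ) :
    ∑ i ∈ Finset.range p, wsum v i n = n * wsum v 0 p := by
  induction n with
  | zero => simp [wsum_zero]
  | succ n ih =>
    simp only [wsum_succ, Finset.sum_add_distrib, ih]
    have := wsum_eq_sum (v := v) n p
    rw [wsum_period h] at this
    rw [Finset.sum_congr rfl (fun i _ => by rw [add_comm i n]), ← this]
    push_cast; ring

theorem wsum_mod {p : ℕ} (h : ∀ i, v (i + p) = v i) (n i : ℕ) :
    wsum v (i % p) n = wsum v i n := by
  have hp : Function.Periodic v p := h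
  refine wsum_congr fun k _ => ?_
  rw [← hp.map_mod_nat, ← hp.map_mod_nat (i + k), Nat.mod_add_mod]

/-- A periodic word cannot have a class occurring once in each period. -/
theorem AtLeastTwo.false_of_once (h2 : AtLeastTwo v) {p : ℕ} (hp : 0 < p)
    (h : ∀ i, v (i + p) = v i) {n i₀ : ℕ}
    (ho : ∀ j, wsum v j n = wsum v i₀ n → j % p = i₀ % p) : False := by
  have hper : Function.Periodic v p := h
  obtain ⟨x₁, y₁, x₂, y₂, R1, R2, hne⟩ := h2 n i₀
  have main : ∀ x y, IsRet v n (wsum v i₀ n) x y → x % p = i₀ % p ∧ y = x + p := by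
    intro x y R
    have e1 := ho x R.2.1
    have e2 := ho y R.2.2.1
    have hxy := R.1
    refine ⟨e1, ?_⟩
    have e3 : y ≤ x + p := by
      by_contra hlt
      refine R.2.2.2 (x + p) (by omega) (by omega) ?_
      rw [← wsum_mod h, Nat.add_mod_right, wsum_mod h, R.2.1]
    have e4 : p ∣ y - x := (Nat.modEq_iff_dvd' hxy.le).1 (e1.trans e2.symm)
    have := Nat.le_of_dvd (by omega) e4
    omega
  obtain ⟨a1, b1⟩ := main _ _ R1
  obtain ⟨a2, b2⟩ := main _ _ R2
  refine hne ⟨by omega, fun k _ => ?_⟩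
  rw [← hper.map_mod_nat, ← hper.map_mod_nat (x₂ + k), ← Nat.mod_add_mod x₁, a1, ← a2,
    Nat.mod_add_mod]

/-- By `sum_wsum` the mean of the window sums over a period is here an integer. If two consecutive
integers were both attained, the mean would lie strictly between them. -/
theorem Balanced.wsum_const (hbal : Balanced v) {p : ℕ} (hp : 0 < p)
    (h : ∀ i, v (i + p) = v i) {n : ℕ} (hd : (p : ℤ) ∣ n * wsum v 0 p) (i j : ℕ) :
    wsum v i n ≤ wsum v j n := by
  by_contra hlt
  rw [← sum_wsum h] at hd
  obtain ⟨q, hq⟩ := hd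
  have b1 : ∀ k, wsum v j n ≤ wsum v k n := fun k => by have := hbal n i k; omega
  have b2 : ∀ k, wsum v k n ≤ wsum v i n := fun k => by have := hbal n k j; omega
  have e := hbal n i j
  have s1 : ∑ _k ∈ Finset.range p, wsum v j n < ∑ k ∈ Finset.range p, wsum v k n :=
    Finset.sum_lt_sum (fun k _ => b1 k)
      ⟨i % p, Finset.mem_range.2 (Nat.mod_lt _ hp), by rw [wsum_mod h]; omega⟩
  have s2 : ∑ k ∈ Finset.range p, wsum v k n < ∑ _k ∈ Finset.range p, wsum v i n :=
    Finset.sum_lt_sum (fun k _ => b2 k)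
      ⟨j % p, Finset.mem_range.2 (Nat.mod_lt _ hp), by rw [wsum_mod h]; omega⟩
  simp only [Finset.sum_const, Finset.card_range, nsmul_eq_mul, hq] at s1 s2
  have hp' : (0 : ℤ) < p := by exact_mod_cast hp
  have s1' := lt_of_mul_lt_mul_left s1 hp'.le
  have s2' := lt_of_mul_lt_mul_left s2 hp'.le
  omega

/-- A balanced word whose window classes have at least two returns is not periodic. -/
theorem AtLeastTwo.not_periodic (h2 : AtLeastTwo v) (hb : Binary v) (hbal : Balanced v) {p : ℕ}
    (hp : 0 < p) (h : ∀ i, v (i + p) = v i) : False := by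
  classical
  have hex : ∃ p, 0 < p ∧ ∀ i, v (i + p) = v i := ⟨p, hp, h⟩
  obtain ⟨hp, h⟩ := Nat.find_spec hex
  have hmin : ∀ q, 0 < q → (∀ i, v (i + q) = v i) → Nat.find hex ≤ q := fun q h1 h2 =>
    Nat.find_min' hex ⟨h1, h2⟩
  generalize Nat.find hex = p at hp h hmin
  obtain ⟨a, ha⟩ : ∃ a : ℕ, wsum v 0 p = a := by
    refine ⟨(wsum v 0 p).toNat, (Int.toNat_of_nonneg ?_).symm⟩
    have := (hb.le_of_le (show 0 ≤ 0 + p by omega)).1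
    simp only [wsum]; omega
  -- With g = gcd(a, p), windows of length p / g have constant sum, so p / g is a period; minimality
  -- gives g = 1.
  have cop : Nat.Coprime a p := by
    obtain ⟨m, hm⟩ := Nat.gcd_dvd_right a p
    obtain ⟨l, hl⟩ := Nat.gcd_dvd_left a p
    have hm0 : 0 < m := Nat.pos_of_ne_zero (by rintro rfl; omega)
    have hg0 : 0 < Nat.gcd a p := Nat.gcd_pos_of_pos_right _ hp
    have hd : (p : ℤ) ∣ m * wsum v 0 p := by
      rw [ha]
      refine ⟨l, ?_⟩
      have : m * a = p * l := by
        calc m * a = m * (Nat.gcd a p * l) := by rw [← hl]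
          _ = (Nat.gcd a p * m) * l := by ring
          _ = p * l := by rw [← hm]
      exact_mod_cast this
    have hle := hmin m hm0 fun i => by
      have e1 := hbal.wsum_const hp h hd i (i + 1)
      have e2 := hbal.wsum_const hp h hd (i + 1) i
      rw [wsum_shift] at e1 e2
      omega
    have : Nat.gcd a p * m ≤ m := by rw [← hm]; exact hle
    have : Nat.gcd a p ≤ 1 := by nlinarith
    show Nat.gcd a p = 1
    omega
  rcases Nat.eq_or_lt_of_le (show 1 ≤ p from hp) with rfl | hp1
  -- For p = 1 the empty window already occurs once per period.
  · exact h2.false_of_once hp h (n := 0) (i₀ := 0) (fun j _ => by omega)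
  -- With a n ≡ 1 mod p, the excesses over the lower bound c sum over a period to a number in [0, p]
  -- that is 1 mod p, hence to 1: the heavy class occurs once per period.
  obtain ⟨n, -, hn⟩ := Nat.exists_mul_mod_eq_one_of_coprime cop hp1
  obtain ⟨c, hc⟩ := hbal.exists_bounds n
  have hsum := sum_wsum h n
  have hS : ∑ k ∈ Finset.range p, (wsum v k n - c) = n * a - p * c := by
    rw [Finset.sum_sub_distrib, hsum, ha]; simp
  have hmod : (n * a : ℤ) = p * (a * n / p : ℕ) + 1 := by
    have := Nat.div_add_mod (a * n) p
    rw [hn] at this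
    have h' : (p * (a * n / p) + 1 : ℤ) = a * n := by exact_mod_cast this
    push_cast
    linarith
  have hlo : 0 ≤ ∑ k ∈ Finset.range p, (wsum v k n - c) :=
    Finset.sum_nonneg fun k _ => by have := hc k; omega
  have hhi : ∑ k ∈ Finset.range p, (wsum v k n - c) ≤ p := by
    calc _ ≤ ∑ _k ∈ Finset.range p, (1 : ℤ) :=
          Finset.sum_le_sum fun k _ => by have := hc k; omega
      _ = p := by simp
  have hone : ∑ k ∈ Finset.range p, (wsum v k n - c) = 1 := by
    rw [hS, hmod] at hlo hhi ⊢
    have hp' : (1 : ℤ) < p := by exact_mod_cast hp1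
    generalize ((a * n / p : ℕ) : ℤ) = q at *
    have : (p : ℤ) * q + 1 - p * c = p * (q - c) + 1 := by ring
    rw [this] at hlo hhi ⊢
    have : q - c = 0 := by
      rcases lt_trichotomy (q - c) 0 with h | h | h
      · nlinarith
      · exact h
      · nlinarith
    rw [this]; ring
  obtain ⟨i₀, hi₀, hv₀⟩ : ∃ i ∈ Finset.range p, wsum v i n - c ≠ 0 := by
    by_contra hne
    push Not at hne
    rw [Finset.sum_eq_zero hne] at hone
    omega
  refine h2.false_of_once hp h (n := n) (i₀ := i₀) fun j hj => ?_
  rw [Nat.mod_eq_of_lt (Finset.mem_range.1 hi₀)]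
  by_contra hne
  have hsub : ({j % p, i₀} : Finset ℕ) ⊆ Finset.range p := by
    intro x hx
    simp only [Finset.mem_insert, Finset.mem_singleton] at hx
    rcases hx with rfl | rfl
    exacts [Finset.mem_range.2 (Nat.mod_lt _ hp), hi₀]
  have := Finset.sum_le_sum_of_subset_of_nonneg (f := fun k => wsum v k n - c) hsub
    (fun k _ _ => by have := hc k; omega)
  rw [Finset.sum_pair hne, hone, wsum_mod h] at this
  have := hc i₀
  omega

end

/-! ### Factor complexity and right special factors. -/

/-- The block of length `n` of `v` at position `i` is right special. -/
def RightSpecialAt (v : ℕ → ℤ) (n i : ℕ) : Prop :=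
  ∃ j, (∀ k < n, v (j + k) = v (i + k)) ∧ v (j + n) ≠ v (i + n)

/-- For every length there is exactly one right special factor. -/
def UniqueRightSpecial (v : ℕ → ℤ) : Prop :=
  ∀ n, (∃ i, RightSpecialAt v n i) ∧ ∀ i j, RightSpecialAt v n i → RightSpecialAt v n j →
    ∀ k < n, v (i + k) = v (j + k)

section complexity
variable (w : ℕ → Fin 2)

/-- The integer sequence of the letters of `w`. -/
def toSeq (i : ℕ) : ℤ := (w i : ℕ)

theorem toSeq_inj {i j : ℕ} : toSeq w i = toSeq w j ↔ w i = w j := by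
  simp [toSeq, Fin.ext_iff]

theorem toSeq_binary : Binary (toSeq w) := fun i => by
  have := (w i).isLt
  simp only [toSeq]; omega

theorem length_wordAt (i n : ℕ) : (wordAt w i n).length = n := by simp [wordAt]

theorem wordAt_eq_iff {i j n : ℕ} :
    wordAt w i n = wordAt w j n ↔ ∀ k < n, w (i + k) = w (j + k) := by
  simp [wordAt]

theorem wordAt_succ (i n : ℕ) : wordAt w i (n + 1) = wordAt w i n ++ [w (i + n)] := by
  simp [wordAt, List.range_succ]

/-- The factors of length `n`. -/
def factors (n : ℕ) : Set (List (Fin 2)) := Set.range fun i => wordAt w i n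

theorem complexity_eq (n : ℕ) : complexity w n = (factors w n).ncard := by
  unfold complexity factors
  congr 1
  ext u
  constructor
  · rintro ⟨⟨i, hi⟩, rfl⟩
    exact ⟨i, hi⟩
  · rintro ⟨i, rfl⟩
    exact ⟨⟨i, by rw [length_wordAt]⟩, length_wordAt w i n⟩

theorem finite_factors (n : ℕ) : (factors w n).Finite :=
  (List.finite_length_eq (Fin 2) n).subset (by rintro _ ⟨i, rfl⟩; exact length_wordAt w i n)

/-- The words followed by the letter `b` with `n` letters before it. -/
def extBy (n : ℕ) (b : Fin 2) : Set (List (Fin 2)) :=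
  {u | ∃ i, wordAt w i n = u ∧ w (i + n) = b}

theorem extBy_subset (n : ℕ) (b : Fin 2) : extBy w n b ⊆ factors w n := by
  rintro _ ⟨i, rfl, -⟩
  exact ⟨i, rfl⟩

/-- Each factor has one or two right extensions, and the right special ones are counted twice. -/
theorem complexity_succ (n : ℕ) :
    complexity w (n + 1) = complexity w n + (extBy w n 0 ∩ extBy w n 1).ncard := by
  have fin : ∀ b, (extBy w n b).Finite := fun b => (finite_factors w n).subset (extBy_subset w n b)
  have e1 : factors w n = extBy w n 0 ∪ extBy w n 1 := by
    refine Set.Subset.antisymm ?_ (Set.union_subset (extBy_subset w n 0) (extBy_subset w n 1))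
    rintro _ ⟨i, rfl⟩
    rcases Fin.exists_fin_two.1 ⟨w (i + n), rfl⟩ with h | h
    exacts [Or.inl ⟨i, rfl, h⟩, Or.inr ⟨i, rfl, h⟩]
  have e2 : factors w (n + 1) =
      (fun u => u ++ [0]) '' extBy w n 0 ∪ (fun u => u ++ [1]) '' extBy w n 1 := by
    ext u
    constructor
    · rintro ⟨i, rfl⟩
      simp only [wordAt_succ]
      rcases Fin.exists_fin_two.1 ⟨w (i + n), rfl⟩ with h | h
      exacts [Or.inl ⟨_, ⟨i, rfl, h⟩, by rw [h]⟩, Or.inr ⟨_, ⟨i, rfl, h⟩, by rw [h]⟩]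
    · rintro (⟨_, ⟨i, rfl, h⟩, rfl⟩ | ⟨_, ⟨i, rfl, h⟩, rfl⟩)
      exacts [⟨i, by simp only [wordAt_succ, h]⟩, ⟨i, by simp only [wordAt_succ, h]⟩]
  have inj : ∀ b : Fin 2, Function.Injective fun u : List (Fin 2) => u ++ [b] := fun b =>
    List.append_left_injective [b]
  have disj : Disjoint ((fun u => u ++ [0]) '' extBy w n 0) ((fun u => u ++ [1]) '' extBy w n 1) := by
    rw [Set.disjoint_left]
    rintro _ ⟨a, -, rfl⟩ ⟨b, -, h⟩
    have := List.append_inj_right' h rfl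
    simp at this
  rw [complexity_eq, complexity_eq, e2, Set.ncard_union_eq disj ((fin 0).image _) ((fin 1).image _),
    Set.ncard_image_of_injective _ (inj 0), Set.ncard_image_of_injective _ (inj 1), e1,
    Set.ncard_union_add_ncard_inter _ _ (fin 0) (fin 1)]

theorem complexity_zero : complexity w 0 = 1 := by
  rw [complexity_eq, Set.ncard_eq_one]
  exact ⟨[], by ext u; simp [factors, wordAt]⟩

theorem mem_extBy_inter {n i : ℕ} :
    wordAt w i n ∈ extBy w n 0 ∩ extBy w n 1 ↔ RightSpecialAt (toSeq w) n i := by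
  constructor
  · rintro ⟨⟨a, ha, ha'⟩, b, hb, hb'⟩
    rw [wordAt_eq_iff] at ha hb
    rcases Fin.exists_fin_two.1 ⟨w (i + n), rfl⟩ with h | h
    · refine ⟨b, fun k hk => (toSeq_inj w).2 (hb k hk), ?_⟩
      rw [Ne, toSeq_inj, hb', h]; decide
    · refine ⟨a, fun k hk => (toSeq_inj w).2 (ha k hk), ?_⟩
      rw [Ne, toSeq_inj, ha', h]; decide
  · rintro ⟨j, hj, hne⟩
    have hj' : wordAt w j n = wordAt w i n := by
      rw [wordAt_eq_iff]
      exact fun k hk => (toSeq_inj w).1 (hj k hk)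
    rw [Ne, toSeq_inj] at hne
    have h1 := (w (j + n)).isLt
    have h2 := (w (i + n)).isLt
    have h3 : (w (j + n) = 0 ∧ w (i + n) = 1) ∨ (w (j + n) = 1 ∧ w (i + n) = 0) := by
      simp only [Fin.ext_iff] at hne ⊢
      simp
      omega
    rcases h3 with ⟨h, h'⟩ | ⟨h, h'⟩
    exacts [⟨⟨j, hj', h⟩, i, rfl, h'⟩, ⟨⟨i, rfl, h'⟩, j, hj', h⟩]

theorem sturmian_iff : Sturmian w ↔ UniqueRightSpecial (toSeq w) := by
  have h1 : Sturmian w ↔ ∀ n, (extBy w n 0 ∩ extBy w n 1).ncard = 1 := by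
    constructor
    · intro h n
      have a := h n
      have b := h (n + 1)
      have := complexity_succ w n
      omega
    · intro h n
      induction n with
      | zero => exact complexity_zero w
      | succ n ih => rw [complexity_succ, ih, h n]
  rw [h1]
  refine forall_congr' fun n => ?_
  rw [Set.ncard_eq_one]
  constructor
  · rintro ⟨u, hu⟩
    have hmem : u ∈ extBy w n 0 ∩ extBy w n 1 := by rw [hu]; rfl
    obtain ⟨i, hi, -⟩ := hmem.1
    refine ⟨⟨i, (mem_extBy_inter w).1 (by rw [hi]; exact hmem)⟩, fun a b ha hb k hk => ?_⟩
    have ha' := (mem_extBy_inter w).2 ha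
    have hb' := (mem_extBy_inter w).2 hb
    rw [hu, Set.mem_singleton_iff] at ha' hb'
    exact (toSeq_inj w).2 ((wordAt_eq_iff w).1 (ha'.trans hb'.symm) k hk)
  · rintro ⟨⟨i, hi⟩, huniq⟩
    refine ⟨wordAt w i n, Set.eq_singleton_iff_unique_mem.2 ⟨(mem_extBy_inter w).2 hi, ?_⟩⟩
    intro x hx
    obtain ⟨a, rfl, -⟩ := hx.1
    rw [wordAt_eq_iff]
    exact fun k hk => (toSeq_inj w).1 (huniq a i ((mem_extBy_inter w).1 hx) hi k hk)

end complexity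

/-! ### Aperiodicity, special factors, and balance of Sturmian words. -/

section
variable {v : ℕ → ℤ}

/-- No positive number is a period. -/
def Aperiodic (v : ℕ → ℤ) : Prop := ∀ p, 0 < p → ∃ i, v (i + p) ≠ v i

theorem Recur.periodic_of_eventually (hr : Recur v) {p a : ℕ} (h : ∀ m, v (a + m + p) = v (a + m))
    (i : ℕ) : v (i + p) = v i := by
  obtain ⟨j, hj, e⟩ := hr i (p + 1) a
  have h1 := e 0 (by omega)
  have h2 := e p (by omega)
  have h3 := h (j - a)
  rw [show a + (j - a) = j by omega] at h3
  rw [← h2, h3]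
  simpa using h1

theorem RightSpecialAt.congr {n i j : ℕ} (h : RightSpecialAt v n i)
    (e : ∀ k < n, v (i + k) = v (j + k)) : RightSpecialAt v n j := by
  obtain ⟨l, hl, hne⟩ := h
  by_cases hj : v (j + n) = v (i + n)
  · exact ⟨l, fun k hk => (hl k hk).trans (e k hk), by rwa [hj]⟩
  · exact ⟨i, e, Ne.symm hj⟩

theorem RightSpecialAt.exists_next (hb : Binary v) {n i : ℕ} (h : RightSpecialAt v n i) {x : ℤ}
    (hx : x = 0 ∨ x = 1) : ∃ j, (∀ k < n, v (j + k) = v (i + k)) ∧ v (j + n) = x := by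
  obtain ⟨l, hl, hne⟩ := h
  by_cases hi : v (i + n) = x
  · exact ⟨i, fun _ _ => rfl, hi⟩
  · refine ⟨l, hl, ?_⟩
    rcases hb (i + n) with h1 | h1 <;> rcases hb (l + n) with h2 | h2 <;> omega

/-- Take the last place where two right special blocks differ, and let u be the common suffix after
it. Then 0u and 1u are both right special, so 0u0 and 1u1 occur, against balance. -/
theorem Balanced.rightSpecial_unique (hbal : Balanced v) (hb : Binary v) {n i j : ℕ}
    (hi : RightSpecialAt v n i) (hj : RightSpecialAt v n j) : ∀ k < n, v (i + k) = v (j + k) := by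
  by_contra hne
  push Not at hne
  obtain ⟨k₀, hk₀, hne₀⟩ := hne
  obtain ⟨k, -, hk, hne, heq⟩ := exists_last (p := fun k => v (i + k) ≠ v (j + k)) hk₀ hne₀
  push Not at heq
  obtain ⟨a, ha, ha'⟩ := hi.exists_next hb (hb (i + k))
  obtain ⟨b, hb', hb''⟩ := hj.exists_next hb (hb (j + k))
  have key : ∀ a, wsum v (a + k) (n - k + 1) =
      v (a + k) + wsum v (a + k + 1) (n - k - 1) + v (a + n) := by
    intro a
    rw [wsum_succ, show n - k = 1 + (n - k - 1) by omega, wsum_add, wsum_one,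
      show a + k + (1 + (n - k - 1)) = a + n by omega, show 1 + (n - k - 1) - 1 = n - k - 1 by omega]
  have mid : wsum v (a + k + 1) (n - k - 1) = wsum v (b + k + 1) (n - k - 1) := by
    refine wsum_congr fun m hm => ?_
    rw [show a + k + 1 + m = a + (k + 1 + m) by omega, show b + k + 1 + m = b + (k + 1 + m) by omega,
      ha _ (by omega), hb' _ (by omega)]
    exact heq _ (by omega) (by omega)
  have e1 := hbal (n - k + 1) (a + k) (b + k)
  have e2 := hbal (n - k + 1) (b + k) (a + k)
  rw [key, key, ha', hb'', ha k hk, hb' k hk, mid] at e1 e2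
  rcases hb (i + k) with h1 | h1 <;> rcases hb (j + k) with h2 | h2 <;> omega

/-- Otherwise each block of length n determines the next letter. By pigeonhole a block repeats, so
the word is eventually periodic, and periodic by recurrence. -/
theorem Aperiodic.exists_rightSpecial (hap : Aperiodic v) (hb : Binary v) (hr : Recur v) (n : ℕ) :
    ∃ i, RightSpecialAt v n i := by
  by_contra hne
  obtain ⟨a, b, hab, e⟩ := Finite.exists_ne_map_eq_of_infinite
    (fun i : ℕ => fun k : Fin n => (v (i + k) = 1 : Prop))
  have e' : ∀ k < n, v (a + k) = v (b + k) := by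
    intro k hk
    have := congrFun e ⟨k, hk⟩
    simp only [eq_iff_iff] at this
    rcases hb (a + k) with h1 | h1 <;> rcases hb (b + k) with h2 | h2 <;> simp_all
  wlog hlt : a < b generalizing a b
  · exact this b a hab.symm e.symm (fun k hk => (e' k hk).symm) (by omega)
  have step : ∀ m, v (a + m) = v (b + m) := by
    intro m
    induction m using Nat.strong_induction_on with
    | _ m ih =>
      rcases Nat.lt_or_ge m n with h | h
      · exact e' m h
      · by_contra hm
        refine hne ⟨b + (m - n), a + (m - n), fun k hk => ?_, ?_⟩
        · rw [add_assoc, add_assoc]; exact ih _ (by omega)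
        · rwa [show a + (m - n) + n = a + m by omega, show b + (m - n) + n = b + m by omega]
  obtain ⟨i, hi⟩ := hap (b - a) (by omega)
  refine hi (hr.periodic_of_eventually (a := a) (fun m => ?_) i)
  rw [step m]; congr 1; omega

/-- Under a period p the first letter of a block of length p determines the letter after it, so no
such block is right special. -/
theorem UniqueRightSpecial.aperiodic (h : UniqueRightSpecial v) : Aperiodic v := by
  intro p hp
  by_contra hne
  push Not at hne
  obtain ⟨i, j, hj, hji⟩ := (h p).1
  apply hji
  rw [hne, hne]
  simpa using hj 0 hp

/-- Classes of an aperiodic recurrent word have at least two returns. -/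
theorem Aperiodic.atLeastTwo (hap : Aperiodic v) (hr : Recur v) : AtLeastTwo v := by
  intro n i
  by_contra hne
  push Not at hne
  obtain ⟨j, hj⟩ := hr.exists_isRet (v := v) (n := n) (c := wsum v i n) (i := i) rfl
  have occ : ∀ m, IsRet v n (wsum v i n) (i + m * (j - i)) (i + (m + 1) * (j - i)) := by
    intro m
    induction m with
    | zero =>
      have := hj.1
      simpa [show i + (j - i) = j by omega] using hj
    | succ m ih =>
      obtain ⟨l, hl⟩ := hr.exists_isRet ih.2.2.1
      have := (hne _ _ _ _ hj hl).1
      have h1 := hl.1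
      have : l = i + (m + 1 + 1) * (j - i) := by
        rw [add_mul (m + 1)]; omega
      rwa [← this]
  have hq : 0 < j - i := by have := hj.1; omega
  obtain ⟨l, hl⟩ := hap (j - i) hq
  refine hl (hr.periodic_of_eventually (a := i) (fun m => ?_) l)
  have h1 := (hne _ _ _ _ (occ (m / (j - i))) (occ (m / (j - i) + 1))).2 (m % (j - i)) (by
    have := Nat.mod_lt m hq
    rw [add_mul]; omega)
  have h2 := Nat.div_add_mod m (j - i)
  rw [mul_comm] at h2
  rw [add_mul] at h1
  rw [show i + m / (j - i) * (j - i) + m % (j - i) = i + m by omega] at h1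
  rw [h1]
  congr 1
  omega

/-- Consecutive positions without right special factor carry repeated factors. -/
def FewFactors (v : ℕ → ℤ) : Prop :=
  ∀ n b, (∀ k ≤ n, ¬ RightSpecialAt v n (b + k)) →
    ∃ k l, k < l ∧ l ≤ n ∧ ∀ m < n, v (b + k + m) = v (b + l + m)

theorem rightSpecialAt_compl {n i : ℕ} :
    RightSpecialAt (compl v) n i ↔ RightSpecialAt v n i := by
  simp [RightSpecialAt, compl]

theorem FewFactors.compl (h : FewFactors v) : FewFactors (compl v) := by
  intro n b
  simp only [rightSpecialAt_compl]
  intro h'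
  obtain ⟨k, l, hkl, hl, e⟩ := h n b h'
  exact ⟨k, l, hkl, hl, fun m hm => by simp [AbelianReturns.compl, e m hm]⟩

theorem UniqueRightSpecial.compl (h : UniqueRightSpecial v) : UniqueRightSpecial (compl v) := by
  intro n
  simp only [rightSpecialAt_compl]
  refine ⟨(h n).1, fun i j hi hj k hk => ?_⟩
  simp [AbelianReturns.compl, (h n).2 i j hi hj k hk]

/-- Right special factors are met in every stretch of consecutive positions. -/
theorem FewFactors.exists_rightSpecial (hf : FewFactors v) (hr : Recur v) {n r : ℕ}
    (hR : RightSpecialAt v n r) (b : ℕ) : ∃ k ≤ n, RightSpecialAt v n (b + k) := by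
  by_contra hne
  push Not at hne
  obtain ⟨k, l, hkl, hln, e⟩ := hf n b hne
  -- A block that is not right special determines its next letter, so the repetition propagates:
  -- from b + k on, l - k is a period and no right special block occurs. Recurrence contradicts
  -- this.
  have key : ∀ m, ¬ RightSpecialAt v n (b + k + m) ∧
      ∀ q < m + n + 1, v (b + k + q) = v (b + l + q) := by
    intro m
    induction m using Nat.strong_induction_on with
    | _ m ih =>
      have e' : ∀ q < m + n, v (b + k + q) = v (b + l + q) := by
        rcases Nat.eq_zero_or_pos m with rfl | hm
        · simpa using e
        · intro q hq
          exact (ih (m - 1) (by omega)).2 q (by omega)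
      have hns : ¬ RightSpecialAt v n (b + k + m) := by
        rcases Nat.lt_or_ge m (l - k) with h | h
        · rw [add_assoc]; exact hne _ (by omega)
        · intro hRS
          refine (ih (m - (l - k)) (by omega)).1 (hRS.congr fun q hq => ?_)
          have := e' (m - (l - k) + q) (by omega)
          rw [← add_assoc, ← add_assoc] at this
          rw [this, show b + l + (m - (l - k)) = b + k + m by omega]
      refine ⟨hns, fun q hq => ?_⟩
      rcases Nat.lt_or_ge q (m + n) with h | h
      · exact e' q h
      · obtain rfl : q = m + n := by omega
        by_contra hm
        refine hns ⟨b + l + m, fun q hq => ?_, ?_⟩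
        · rw [add_assoc, add_assoc _ m q]
          exact (e' (m + q) (by omega)).symm
        · rw [add_assoc, add_assoc _ m n]
          exact Ne.symm hm
  obtain ⟨j, hj, hj'⟩ := hr r n (b + k)
  refine (key (j - (b + k))).1 ?_
  rw [show b + k + (j - (b + k)) = j by omega]
  exact hR.congr fun m hm => (hj' m hm).symm

/-- Balance below length n forces the extreme windows to be 0u0 and 1u1 with u a palindrome. Then u
is right special, so the right special block of length n - 1 starting with 0 is 0u. It starts at one
of the n positions of an occurrence of 1u1, necessarily inside u, at a letter 0; the final 1 of 1u1
is then the mirror image of that 0 in u. -/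
theorem MinUnbalanced.false_of_zero {n : ℕ} {c : ℤ} (h : MinUnbalanced v n c) (hb : Binary v) (hr : Recur v)
    (hf : FewFactors v) (hu : UniqueRightSpecial v) {r : ℕ} (hR : RightSpecialAt v (n - 1) r)
    (h0 : v r = 0) : False := by
  have hn := h.two_le hb
  obtain ⟨a, ha⟩ := h.lo
  obtain ⟨b, hb'⟩ := h.hi
  have hadd : ∀ x k, k ≤ n → wsum v x n = wsum v x k + wsum v (x + k) (n - k) := fun x k hk => by
    rw [← wsum_add, show k + (n - k) = n by omega]
  have pre : ∀ k, 1 ≤ k → k < n → wsum v b k = wsum v a k + 1 := by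
    intro k h1 h2
    have e1 := h.bal k h2 b a
    have e2 := h.bal (n - k) (by omega) (b + k) (a + k)
    have e3 := hadd a k h2.le
    have e4 := hadd b k h2.le
    omega
  have suf : ∀ k, 1 ≤ k → k < n → wsum v b k = wsum v (a + (n - k)) k + 1 := by
    intro k h1 h2
    have e1 := h.bal k h2 b (a + (n - k))
    have e2 := h.bal (n - k) (by omega) (b + k) a
    have e3 := hadd a (n - k) (by omega)
    have e4 := hadd b k h2.le
    rw [show n - (n - k) = k by omega] at e3
    omega
  have ends : v a = 0 ∧ v b = 1 ∧ v (b + (n - 1)) = 1 ∧ v (a + (n - 1)) = 0 := by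
    have e1 := pre 1 le_rfl (by omega)
    have e2 := suf 1 le_rfl (by omega)
    have e3 := hadd a (n - 1) (by omega)
    have e4 := hadd b (n - 1) (by omega)
    have e5 := pre (n - 1) (by omega) (by omega)
    rw [wsum_one, wsum_one] at e1 e2
    rw [show n - (n - 1) = 1 by omega, wsum_one] at e3 e4
    rcases hb a with h1 | h1 <;> rcases hb b with h2 | h2 <;> omega
  have mid : ∀ k, 1 ≤ k → k + 1 < n → v (b + k) = v (a + k) := by
    intro k h1 h2
    have e1 := pre k h1 (by omega)
    have e2 := pre (k + 1) (by omega) h2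
    rw [wsum_succ, wsum_succ] at e2
    omega
  have pal : ∀ k, 1 ≤ k → k + 1 < n → v (a + k) = v (a + (n - 1 - k)) := by
    intro k h1 h2
    have e1 := pre k h1 (by omega)
    have e2 := pre (k + 1) (by omega) h2
    have e3 := suf k h1 (by omega)
    have e4 := suf (k + 1) (by omega) h2
    have e5 := wsum_add (v := v) (a + (n - (k + 1))) 1 k
    rw [show 1 + k = k + 1 by omega, wsum_one,
      show a + (n - (k + 1)) + 1 = a + (n - k) by omega] at e5
    have e6 := wsum_succ (v := v) b k
    have e7 := wsum_succ (v := v) a k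
    rw [show n - 1 - k = n - (k + 1) by omega]
    omega
  -- the right special factor at `r` is `0` followed by the common middle part
  have hR1 : RightSpecialAt v (n - 2) (r + 1) := by
    obtain ⟨j, hj, hne⟩ := hR
    refine ⟨j + 1, fun k hk => ?_, ?_⟩
    · rw [add_assoc, add_assoc]; exact hj _ (by omega)
    · rwa [show j + 1 + (n - 2) = j + (n - 1) by omega,
        show r + 1 + (n - 2) = r + (n - 1) by omega]
  have hA : RightSpecialAt v (n - 2) (a + 1) := by
    refine ⟨b + 1, fun k hk => ?_, ?_⟩
    · rw [add_assoc, add_assoc]; exact mid _ (by omega) (by omega)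
    · rw [show b + 1 + (n - 2) = b + (n - 1) by omega,
        show a + 1 + (n - 2) = a + (n - 1) by omega]
      omega
  have hp := (hu (n - 2)).2 _ _ hR1 hA
  obtain ⟨k, hk, hRk⟩ := hf.exists_rightSpecial hr hR b
  have hq := (hu (n - 1)).2 _ _ hRk hR
  have hq0 : v (b + k) = 0 := by
    have := hq 0 (by omega)
    simpa [h0] using this
  have hk0 : k ≠ 0 := by rintro rfl; simp at hq0; omega
  have hkn : k ≠ n - 1 := by rintro rfl; omega
  have e1 := hq (n - 1 - k) (by omega)
  rw [show b + k + (n - 1 - k) = b + (n - 1) by omega, ends.2.2.1] at e1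
  have e2 := hp (n - 2 - k) (by omega)
  rw [show r + 1 + (n - 2 - k) = r + (n - 1 - k) by omega, ← e1,
    show a + 1 + (n - 2 - k) = a + (n - 1 - k) by omega, ← pal k (by omega) (by omega),
    ← mid k (by omega) (by omega), hq0] at e2
  omega

theorem UniqueRightSpecial.balanced (hu : UniqueRightSpecial v) (hb : Binary v) (hr : Recur v)
    (hf : FewFactors v) : Balanced v := by
  by_contra hbal
  obtain ⟨n, c, h⟩ := exists_minUnbalanced hb hbal
  obtain ⟨r, hR⟩ := (hu (n - 1)).1
  rcases hb r with h0 | h1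
  · exact h.false_of_zero hb hr hf hu hR h0
  · exact h.compl.false_of_zero hb.compl hr.compl hf.compl hu.compl (rightSpecialAt_compl.2 hR)
      (by simp [AbelianReturns.compl, h1])

/-- Besides the right special factor there are only n factors of length n, for n + 1 positions. -/
theorem Sturmian.fewFactors {w : ℕ → Fin 2} (h : Sturmian w) : FewFactors (toSeq w) := by
  intro n b hb
  obtain ⟨r, hr⟩ := ((sturmian_iff w).1 h n).1
  have hmem : wordAt w r n ∈ factors w n := ⟨r, rfl⟩
  have hcard : (factors w n \ {wordAt w r n}).ncard < (Set.Iic n).ncard := by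
    rw [Set.ncard_sdiff_singleton_of_mem hmem, ← complexity_eq, h n]
    simp [Set.ncard_eq_toFinset_card']
  obtain ⟨k, hk, l, hl, hkl, e⟩ := Set.exists_ne_map_eq_of_ncard_lt_of_maps_to hcard
    (f := fun k => wordAt w (b + k) n) (fun k hk => by
      refine ⟨⟨_, rfl⟩, fun heq => hb k hk ?_⟩
      rw [Set.mem_singleton_iff, wordAt_eq_iff] at heq
      exact hr.congr fun m hm => ((toSeq_inj w).2 (heq m hm)).symm)
    ((finite_factors w n).subset Set.sdiff_subset)
  rw [wordAt_eq_iff] at e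
  rcases lt_or_gt_of_ne hkl with h' | h'
  · exact ⟨k, l, h', hl, fun m hm => (toSeq_inj w).2 (e m hm)⟩
  · exact ⟨l, k, h', hk, fun m hm => (toSeq_inj w).2 (e m hm).symm⟩

end

/-! ### Coding by a rotation, and the three-gap argument. -/

section
variable {v : ℕ → ℤ}

theorem wsum_mul_le {n : ℕ} {C : ℝ} (h : ∀ i, (wsum v i n : ℝ) ≤ C) (k i : ℕ) :
    (wsum v i (k * n) : ℝ) ≤ k * C := by
  induction k with
  | zero => simp [wsum_zero]
  | succ k ih =>
    rw [add_mul, one_mul, wsum_add]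
    push_cast
    have := h (i + k * n)
    linarith

theorem le_wsum_mul {n : ℕ} {C : ℝ} (h : ∀ i, C ≤ (wsum v i n : ℝ)) (k i : ℕ) :
    k * C ≤ (wsum v i (k * n) : ℝ) := by
  induction k with
  | zero => simp [wsum_zero]
  | succ k ih =>
    rw [add_mul, one_mul, wsum_add]
    push_cast
    have := h (i + k * n)
    linarith

/-- A balanced word has a slope. -/
theorem Balanced.exists_slope (hbal : Balanced v) : ∃ α : ℝ, ∀ (n : ℕ) (c : ℤ),
    (∀ i, c ≤ wsum v i n ∧ wsum v i n ≤ c + 1) → (c : ℝ) ≤ n * α ∧ n * α ≤ c + 1 := by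
  -- Densities that bound the windows of some length from below. Comparing windows of length m n
  -- bounds them by the upper densities, so the supremum is the slope.
  set A : Set ℝ := {q | ∃ m : ℕ, 0 < m ∧ ∀ i, q * m ≤ (wsum v i m : ℝ)} with hA
  have key : ∀ q ∈ A, ∀ (n : ℕ) (C : ℝ), 0 < n → (∀ i, (wsum v i n : ℝ) ≤ C) → q ≤ C / n := by
    rintro q ⟨m, hm, hq⟩ n C hn hC
    have e1 := le_wsum_mul hq n 0
    have e2 := wsum_mul_le hC m 0
    rw [mul_comm n m] at e1
    have hn' : (0 : ℝ) < n := by exact_mod_cast hn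
    have hm' : (0 : ℝ) < m := by exact_mod_cast hm
    rw [le_div_iff₀ hn']
    have e3 : m * (q * n) ≤ m * C := by linarith
    exact le_of_mul_le_mul_left e3 hm'
  obtain ⟨c₁, hc₁⟩ := hbal.exists_bounds 1
  have up : ∀ {n : ℕ} {c : ℤ}, (∀ i, c ≤ wsum v i n ∧ wsum v i n ≤ c + 1) →
      ∀ i, (wsum v i n : ℝ) ≤ c + 1 := fun h i => by exact_mod_cast (h i).2
  have dn : ∀ {n : ℕ} {c : ℤ}, (∀ i, c ≤ wsum v i n ∧ wsum v i n ≤ c + 1) →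
      ∀ i, (c : ℝ) ≤ wsum v i n := fun h i => by exact_mod_cast (h i).1
  have mem : ∀ {n : ℕ} {c : ℤ}, 0 < n → (∀ i, c ≤ wsum v i n ∧ wsum v i n ≤ c + 1) →
      (c : ℝ) / n ∈ A := fun {n c} hn h => ⟨n, hn, fun i => by
        have hn' : (0 : ℝ) < n := by exact_mod_cast hn
        rw [div_mul_cancel₀ _ hn'.ne']; exact dn h i⟩
  have bdd : BddAbove A := ⟨_, fun q hq => key q hq 1 _ one_pos (up hc₁)⟩
  refine ⟨sSup A, fun n c h => ?_⟩
  rcases Nat.eq_zero_or_pos n with rfl | hn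
  · have := h 0
    rw [wsum_zero] at this
    have h1 : (c : ℝ) ≤ 0 := by exact_mod_cast this.1
    have h2 : (0 : ℝ) ≤ c + 1 := by exact_mod_cast this.2
    exact ⟨by simpa using h1, by simpa using h2⟩
  · have hn' : (0 : ℝ) < n := by exact_mod_cast hn
    constructor
    · have := le_csSup bdd (mem hn h)
      rw [div_le_iff₀ hn'] at this
      linarith
    · have := csSup_le ⟨_, mem hn h⟩ (fun q hq => key q hq n _ hn (up h))
      rw [le_div_iff₀ hn'] at this
      linarith

/-- If m α = a, windows of length k m have sum within one of k a. Windows of length m deviate from a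
in one direction only, and aperiodicity provides one that does deviate. It recurs at two positions
congruent mod m; the stretch tiled from one through the other deviates by at least two. -/
theorem Balanced.slope_ne_int (hbal : Balanced v) (hap : Aperiodic v) (hr : Recur v) {α : ℝ}
    (hα : ∀ (n : ℕ) (c : ℤ),
      (∀ i, c ≤ wsum v i n ∧ wsum v i n ≤ c + 1) → (c : ℝ) ≤ n * α ∧ n * α ≤ c + 1)
    {m : ℕ} (hm : 0 < m) (a : ℤ) : (m : ℝ) * α ≠ a := by
  intro hma
  have near : ∀ k i, k * a - 1 ≤ wsum v i (k * m) ∧ wsum v i (k * m) ≤ k * a + 1 := by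
    intro k i
    obtain ⟨c, hc⟩ := hbal.exists_bounds (k * m)
    obtain ⟨h1, h2⟩ := hα _ c hc
    have e : ((k * m : ℕ) : ℝ) * α = ((k * a : ℤ) : ℝ) := by
      push_cast
      rw [mul_assoc, hma]
    rw [e] at h1 h2
    have h1' : c ≤ k * a := by exact_mod_cast h1
    have h2' : k * a ≤ c + 1 := by exact_mod_cast h2
    have := hc i
    omega
  obtain ⟨c, hc⟩ := hbal.exists_bounds m
  have hca : c ≤ a ∧ a ≤ c + 1 := by
    obtain ⟨h1, h2⟩ := hα _ c hc
    rw [hma] at h1 h2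
    exact ⟨by exact_mod_cast h1, by exact_mod_cast h2⟩
  obtain ⟨i, hi⟩ : ∃ i, wsum v i m ≠ a := by
    by_contra hne
    push Not at hne
    obtain ⟨i, hi⟩ := hap m hm
    have := wsum_shift (v := v) i m
    rw [hne, hne] at this
    omega
  have inf : {j | wsum v j m = wsum v i m}.Infinite := by
    rw [Set.infinite_iff_exists_gt]
    intro N
    obtain ⟨j, hj, e⟩ := hr.exists_wsum m i (N + 1)
    exact ⟨j, e, hj⟩
  obtain ⟨x, hx, y, hy, hxy, e⟩ := inf.exists_ne_map_eq_of_mapsTo (f := fun j => j % m)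
    (t := Set.Iio m) (fun j _ => Nat.mod_lt j hm) (Set.finite_Iio m)
  wlog hlt : x < y generalizing x y
  · exact this y hy x hx hxy.symm e.symm (by omega)
  simp only [Set.mem_ofPred_eq] at hx hy
  obtain ⟨k, hk⟩ := (Nat.modEq_iff_dvd' hlt.le).1 e
  have hk0 : k ≠ 0 := by rintro rfl; omega
  obtain ⟨l, rfl⟩ := Nat.exists_eq_succ_of_ne_zero hk0
  have hsplit : wsum v x ((l + 2) * m) = wsum v i m + wsum v (x + m) (l * m) + wsum v i m := by
    rw [show (l + 2) * m = m + l * m + m by ring, wsum_add, wsum_add, hx]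
    congr 1
    rw [← hy]
    congr 1
    rw [Nat.succ_eq_add_one] at hk
    have : m * (l + 1) = m + l * m := by ring
    omega
  have hn := near (l + 2) x
  rw [hsplit] at hn
  push_cast at hn
  have hci := hc i
  rcases eq_or_lt_of_le hca.1 with rfl | hlt'
  · have := le_wsum_mul (v := v) (n := m) (C := c) (fun i => by exact_mod_cast (hc i).1) l (x + m)
    have : (l * c : ℤ) ≤ wsum v (x + m) (l * m) := by exact_mod_cast this
    have : ((l : ℤ) + 2) * c = l * c + 2 * c := by ring
    omega
  · have hac : a = c + 1 := by omega
    have := wsum_mul_le (v := v) (n := m) (C := (c + 1 : ℤ))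
      (fun i => by exact_mod_cast (hc i).2) l (x + m)
    have : wsum v (x + m) (l * m) ≤ (l * (c + 1) : ℤ) := by exact_mod_cast this
    have : ((l : ℤ) + 2) * a = l * (c + 1) + 2 * (c + 1) := by rw [hac]; ring
    omega

/-- `x` is an orbit of the rotation of angle `α` coding `v` from position `N` on. -/
structure IsPhase (v : ℕ → ℤ) (α : ℝ) (x : ℕ → ℝ) (N : ℕ) : Prop where
  step : ∀ i n, x (i + n) = x i + n * α - wsum v i n
  pos : ∀ k, N ≤ k → 0 < x k
  lt_one : ∀ k, N ≤ k → x k < 1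
  ne_int : ∀ m : ℕ, 0 < m → ∀ a : ℤ, (m : ℝ) * α ≠ a

theorem Balanced.exists_phase (hbal : Balanced v) (hap : Aperiodic v) (hr : Recur v) :
    ∃ α x N, IsPhase v α x N := by
  obtain ⟨α, hα⟩ := hbal.exists_slope
  have hne : ∀ m : ℕ, 0 < m → ∀ a : ℤ, (m : ℝ) * α ≠ a := fun m hm a =>
    hbal.slope_ne_int hap hr hα hm a
  set D : ℕ → ℝ := fun k => psum v k - k * α with hD
  have hDd : ∀ i n, D (i + n) - D i = wsum v i n - n * α := fun i n => by
    simp only [hD, wsum]; push_cast; ring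
  have near : ∀ i n, |D (i + n) - D i| ≤ 1 := by
    intro i n
    obtain ⟨c, hc⟩ := hbal.exists_bounds n
    obtain ⟨h1, h2⟩ := hα n c hc
    have h3 : (c : ℝ) ≤ wsum v i n := by exact_mod_cast (hc i).1
    have h4 : (wsum v i n : ℝ) ≤ c + 1 := by exact_mod_cast (hc i).2
    rw [hDd, abs_le]
    constructor <;> linarith
  have near' : ∀ i j, D i ≤ D j + 1 := by
    intro i j
    rcases le_total i j with h | h
    · have := near i (j - i)
      rw [show i + (j - i) = j by omega, abs_le] at this
      linarith
    · have := near j (i - j)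
      rw [show j + (i - j) = i by omega, abs_le] at this
      linarith
  have bdd : BddAbove (Set.range D) := ⟨D 0 + 1, by rintro _ ⟨i, rfl⟩; exact near' i 0⟩
  set x : ℕ → ℝ := fun k => sSup (Set.range D) - D k with hx
  have h0 : ∀ k, 0 ≤ x k := fun k => sub_nonneg.2 (le_csSup bdd ⟨k, rfl⟩)
  have h1 : ∀ k, x k ≤ 1 := fun k => by
    have : sSup (Set.range D) ≤ D k + 1 :=
      csSup_le ⟨_, 0, rfl⟩ (by rintro _ ⟨i, rfl⟩; exact near' i k)
    simp only [hx]; linarith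
  have inj : Function.Injective x := by
    intro i j hij
    by_contra hne'
    wlog hlt : i < j generalizing i j
    · exact this hij.symm (Ne.symm hne') (by omega)
    have := hDd i (j - i)
    rw [show i + (j - i) = j by omega] at this
    simp only [hx] at hij
    exact hne (j - i) (by omega) (wsum v i (j - i)) (by linarith)
  -- Phases are distinct by irrationality, so the endpoints 0 and 1 are attained finitely often; `N`
  -- lies beyond those indices.
  have fin : (x ⁻¹' {0, 1}).Finite := Set.Finite.preimage inj.injOn (by simp)
  obtain ⟨M, hM⟩ := fin.bddAbove
  have hout : ∀ k, M + 1 ≤ k → x k ≠ 0 ∧ x k ≠ 1 := fun k hk => by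
    constructor <;> intro h <;>
    · have : k ∈ x ⁻¹' {0, 1} := by simp [h]
      have := hM this
      omega
  refine ⟨α, x, M + 1, fun i n => ?_, fun k hk => lt_of_le_of_ne (h0 k) (hout k hk).1.symm,
    fun k hk => lt_of_le_of_ne (h1 k) (hout k hk).2, hne⟩
  have := hDd i n
  simp only [hx]; linarith

namespace IsPhase
variable {α : ℝ} {x : ℕ → ℝ} {N : ℕ}

theorem eq_of_mem (h : IsPhase v α x N) {i m : ℕ} (hi : N ≤ i) {a : ℤ}
    (h0 : 0 < x i + (m * α - a)) (h1 : x i + (m * α - a) < 1) :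
    x (i + m) = x i + (m * α - a) := by
  have e := h.step i m
  have p := h.pos (i + m) (by omega)
  have q := h.lt_one (i + m) (by omega)
  have h2 : (wsum v i m - a : ℤ) < 1 := by
    have : ((wsum v i m - a : ℤ) : ℝ) < 1 := by push_cast; linarith
    exact_mod_cast this
  have h3 : (-1 : ℤ) < wsum v i m - a := by
    have : (-1 : ℝ) < ((wsum v i m - a : ℤ) : ℝ) := by push_cast; linarith
    exact_mod_cast this
  have h4 : wsum v i m = a := by omega
  rw [e, h4]; ring

/-- The class is where both the phase and its translate by n α - c lie in (0, 1). This interval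
reaches an end of (0, 1), which `sameSeg` relies on. -/
theorem exists_interval (h : IsPhase v α x N) (n : ℕ) (c : ℤ) : ∃ lo hi : ℝ, 0 ≤ lo ∧ hi ≤ 1 ∧
    (lo = 0 ∨ hi = 1) ∧ ∀ i, N ≤ i → (wsum v i n = c ↔ lo < x i ∧ x i < hi) := by
  refine ⟨max 0 (c - n * α), min 1 (1 - (n * α - c)), le_max_left _ _, min_le_left _ _, ?_, ?_⟩
  · rcases le_total (n * α - c) 0 with h' | h'
    · exact Or.inr (min_eq_left (by linarith))
    · exact Or.inl (max_eq_left (by linarith))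
  · intro i hi
    have p := h.pos i hi
    have q := h.lt_one i hi
    have e := h.step i n
    rw [max_lt_iff, lt_min_iff]
    constructor
    · rintro rfl
      have p' := h.pos (i + n) (by omega)
      have q' := h.lt_one (i + n) (by omega)
      refine ⟨⟨p, ?_⟩, q, ?_⟩ <;> linarith
    · rintro ⟨⟨-, h1⟩, -, h2⟩
      have := h.eq_of_mem (m := n) (a := c) hi (by linarith) (by linarith)
      have : (wsum v i n : ℝ) = c := by linarith
      exact_mod_cast this

theorem int_unique (h : IsPhase v α x N) {m m' : ℕ} {a a' : ℤ}
    (e : m * α - a = m' * α - a') : m = m' := by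
  rcases lt_trichotomy m m' with hlt | hlt | hlt
  · refine absurd ?_ (h.ne_int (m' - m) (by omega) (a' - a))
    push_cast [Nat.cast_sub hlt.le]
    linarith
  · exact hlt
  · refine absurd ?_ (h.ne_int (m - m') (by omega) (a - a'))
    push_cast [Nat.cast_sub hlt.le]
    linarith

/-- The word of a return is determined by its displacement. -/
theorem sameSeg (h : IsPhase v α x N) (hb : Binary v) {n : ℕ} {c : ℤ} {i j i' j' : ℕ} (hi : N ≤ i)
    (hi' : N ≤ i') (R : IsRet v n c i j) (R' : IsRet v n c i' j') (e : x j - x i = x j' - x i') :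
    SameSeg v i j i' j' := by
  obtain ⟨lo, hh, hlo, hhi, hend, hcl⟩ := h.exists_interval n c
  have len : j - i = j' - i' := by
    have e1 := h.step i (j - i)
    have e2 := h.step i' (j' - i')
    have := R.1
    have := R'.1
    rw [show i + (j - i) = j by omega] at e1
    rw [show i' + (j' - i') = j' by omega] at e2
    exact h.int_unique (m := j - i) (m' := j' - i') (a := wsum v i (j - i))
      (a' := wsum v i' (j' - i')) (by linarith)
  refine ⟨len, ?_⟩
  by_contra hne
  push Not at hne
  classical
  obtain ⟨hkm, hk⟩ := Nat.find_spec hne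
  have hmin : ∀ t < Nat.find hne, v (i + t) = v (i' + t) := fun t ht => by
    by_contra h'
    exact Nat.find_min hne ht ⟨by omega, h'⟩
  generalize Nat.find hne = k at hkm hk hmin
  clear hne
  wlog hv : v (i + k) = 0 generalizing i j i' j'
  · have h1 : v (i + k) = 1 := (hb _).resolve_left hv
    have h2 : v (i' + k) = 0 := (hb _).resolve_right (by omega)
    exact this hi' hi R' R e.symm len.symm (by omega) (by omega) (fun t ht => (hmin t ht).symm) h2
  have hv' : v (i' + k) = 1 := (hb _).resolve_left (by omega)
  have s1 := h.step i (k + 1)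
  have s2 := h.step i' (k + 1)
  rw [wsum_succ, hv] at s1
  rw [wsum_succ, hv', ← wsum_congr hmin] at s2
  push_cast at s1 s2
  have p1 := h.pos (i' + (k + 1)) (by omega)
  have q1 := h.lt_one (i + (k + 1)) (by omega)
  have c1 := (hcl i hi).1 R.2.1
  have c2 := (hcl i' hi').1 R'.2.1
  -- At the first differing letter the orbit reading 0 has moved up and the one reading 1 has moved
  -- down. As the interval reaches 0 or 1, one of them is inside it again, so the return ends there;
  -- but the displacements then differ by one.
  have hk1 : k + 1 = j - i := by
    by_contra hlt
    rcases hend with h0 | h1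
    · refine R'.2.2.2 (i' + (k + 1)) (by omega) (by omega) ((hcl _ (by omega)).2 ⟨?_, ?_⟩) <;>
        linarith
    · refine R.2.2.2 (i + (k + 1)) (by omega) (by omega) ((hcl _ (by omega)).2 ⟨?_, ?_⟩) <;>
        linarith
  have hij := R.1
  have hij' := R'.1
  rw [show i + (k + 1) = j by omega] at s1
  rw [show i' + (k + 1) = j' by omega] at s2
  linarith

/-- The least positive shift by a displacement in an open interval of length at most one. -/
theorem exists_least {β p q : ℝ} (hpq : q ≤ p + 1) : ∃ (r : ℕ) (a : ℤ), ∀ (m : ℕ) (b : ℤ), 0 < m →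
    p < m * β - b → m * β - b < q →
    0 < r ∧ r ≤ m ∧ p < r * β - a ∧ r * β - a < q ∧ (m = r → b = a) := by
  classical
  by_cases hex : ∃ m : ℕ, 0 < m ∧ ∃ b : ℤ, p < m * β - b ∧ m * β - b < q
  · obtain ⟨h0, a, h1, h2⟩ := Nat.find_spec hex
    refine ⟨Nat.find hex, a, fun m b hm hp hq =>
      ⟨h0, Nat.find_min' hex ⟨hm, b, hp, hq⟩, h1, h2, fun e => ?_⟩⟩
    rw [← e] at h1 h2
    have h3 : ((a - b : ℤ) : ℝ) < 1 := by push_cast; linarith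
    have h4 : (-1 : ℝ) < ((a - b : ℤ) : ℝ) := by push_cast; linarith
    have h3' : a - b < 1 := by exact_mod_cast h3
    have h4' : -1 < a - b := by exact_mod_cast h4
    omega
  · refine ⟨0, 0, fun m b hm hp hq => absurd ⟨m, hm, b, hp, hq⟩ hex⟩

/-- The displacements of the returns to a class take at most three values. -/
theorem exists_displacements (h : IsPhase v α x N) (n : ℕ) (c : ℤ) : ∃ d₁ d₂ : ℝ, ∀ i j, N ≤ i →
    IsRet v n c i j → x j - x i = d₁ ∨ x j - x i = d₂ ∨ x j - x i = d₁ + d₂ := by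
  obtain ⟨lo, hh, hlo, hhi, -, hcl⟩ := h.exists_interval n c
  obtain ⟨r₁, a₁, H1⟩ := exists_least (β := α) (p := 0) (q := hh - lo) (by linarith)
  obtain ⟨r₂, a₂, H2⟩ := exists_least (β := α) (p := -(hh - lo)) (q := 0) (by linarith)
  refine ⟨r₁ * α - a₁, r₂ * α - a₂, fun i j hi R => ?_⟩
  have hij := R.1
  have s := h.step i (j - i)
  rw [show i + (j - i) = j by omega] at s
  have c1 := (hcl i hi).1 R.2.1
  have c2 := (hcl j (by omega)).1 R.2.2.1
  -- a shifted position inside the interval is an occurrence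
  have out : ∀ (r : ℕ) (a : ℤ), 0 < r → r < j - i → lo < x i + (r * α - a) →
      x i + (r * α - a) < hh → False := by
    intro r a hr hrm h1 h2
    have e := h.eq_of_mem (m := r) (a := a) hi (by linarith) (by linarith)
    exact R.2.2.2 (i + r) (by omega) (by omega)
      ((hcl _ (by omega)).2 ⟨by rw [e]; exact h1, by rw [e]; exact h2⟩)
  -- If the upward shift leaves the interval at the top and the downward one at the bottom, their
  -- sum stays inside, because each is shorter than the interval.
  have fin : 0 < r₁ → 0 < r₂ → r₁ + r₂ ≤ j - i → hh ≤ x i + (r₁ * α - a₁) →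
      r₁ * α - a₁ < hh - lo → x i + (r₂ * α - a₂) ≤ lo → -(hh - lo) < r₂ * α - a₂ →
      x j - x i = r₁ * α - a₁ + (r₂ * α - a₂) := by
    intro p1 p2 hle b1 b2 b3 b4
    rcases Nat.lt_or_ge (r₁ + r₂) (j - i) with hlt | hge
    · exfalso
      refine out (r₁ + r₂) (a₁ + a₂) (by omega) hlt ?_ ?_ <;> push_cast <;> linarith
    · have e := h.eq_of_mem (m := r₁ + r₂) (a := a₁ + a₂) hi (by push_cast; linarith)
        (by push_cast; linarith)
      rw [show i + (r₁ + r₂) = j by omega] at e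
      push_cast at e
      linarith
  have hm : 0 < j - i := by omega
  set m := j - i with hmdef
  set b := wsum v i m with hbdef
  rcases lt_trichotomy ((m : ℝ) * α - b) 0 with hneg | hz | hpos
  · obtain ⟨p2, l2, u2, w2, eq2⟩ := H2 m b hm (by linarith) hneg
    rcases Nat.eq_or_lt_of_le l2 with e | hlt
    · have := eq2 e.symm
      right; left
      rw [e, ← this]; linarith
    · have b3 : x i + (r₂ * α - a₂) ≤ lo := by
        by_contra hc
        exact out r₂ a₂ p2 hlt (by linarith) (by linarith)
      obtain ⟨p1, l1, u1, w1, eq1⟩ := H1 (m - r₂) (b - a₂) (by omega)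
        (by push_cast [Nat.cast_sub hlt.le]; linarith) (by push_cast [Nat.cast_sub hlt.le]; linarith)
      have b1 : hh ≤ x i + (r₁ * α - a₁) := by
        by_contra hc
        exact out r₁ a₁ p1 (by omega) (by linarith) (by linarith)
      exact Or.inr (Or.inr (fin p1 p2 (by omega) b1 w1 b3 u2))
  · exact absurd (by linarith) (h.ne_int m hm b)
  · obtain ⟨p1, l1, u1, w1, eq1⟩ := H1 m b hm hpos (by linarith)
    rcases Nat.eq_or_lt_of_le l1 with e | hlt
    · have := eq1 e.symm
      left
      rw [e, ← this]; linarith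
    · have b1 : hh ≤ x i + (r₁ * α - a₁) := by
        by_contra hc
        exact out r₁ a₁ p1 hlt (by linarith) (by linarith)
      obtain ⟨p2, l2, u2, w2, eq2⟩ := H2 (m - r₁) (b - a₁) (by omega)
        (by push_cast [Nat.cast_sub hlt.le]; linarith) (by push_cast [Nat.cast_sub hlt.le]; linarith)
      have b3 : x i + (r₂ * α - a₂) ≤ lo := by
        by_contra hc
        exact out r₂ a₂ p2 (by omega) (by linarith) (by linarith)
      exact Or.inr (Or.inr (fin p1 p2 (by omega) b1 w1 b3 u2))

end IsPhase

theorem Balanced.atMostThree (hbal : Balanced v) (hb : Binary v) (hap : Aperiodic v)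
    (hr : Recur v) : AtMostThree v := by
  obtain ⟨α, x, N, h⟩ := hbal.exists_phase hap hr
  intro n c i₁ j₁ i₂ j₂ i₃ j₃ i₄ j₄ R1 R2 R3 R4 n12 n13 n14 n23 n24 n34
  obtain ⟨d₁, d₂, hd⟩ := h.exists_displacements n c
  obtain ⟨k₁, l₁, g1, T1, S1⟩ := R1.move hr N
  obtain ⟨k₂, l₂, g2, T2, S2⟩ := R2.move hr N
  obtain ⟨k₃, l₃, g3, T3, S3⟩ := R3.move hr N
  obtain ⟨k₄, l₄, g4, T4, S4⟩ := R4.move hr N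
  have m12 : x l₁ - x k₁ ≠ x l₂ - x k₂ := fun e =>
    n12 ((S1.trans (h.sameSeg hb g1 g2 T1 T2 e)).trans S2.symm)
  have m13 : x l₁ - x k₁ ≠ x l₃ - x k₃ := fun e =>
    n13 ((S1.trans (h.sameSeg hb g1 g3 T1 T3 e)).trans S3.symm)
  have m14 : x l₁ - x k₁ ≠ x l₄ - x k₄ := fun e =>
    n14 ((S1.trans (h.sameSeg hb g1 g4 T1 T4 e)).trans S4.symm)
  have m23 : x l₂ - x k₂ ≠ x l₃ - x k₃ := fun e =>
    n23 ((S2.trans (h.sameSeg hb g2 g3 T2 T3 e)).trans S3.symm)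
  have m24 : x l₂ - x k₂ ≠ x l₄ - x k₄ := fun e =>
    n24 ((S2.trans (h.sameSeg hb g2 g4 T2 T4 e)).trans S4.symm)
  have m34 : x l₃ - x k₃ ≠ x l₄ - x k₄ := fun e =>
    n34 ((S3.trans (h.sameSeg hb g3 g4 T3 T4 e)).trans S4.symm)
  rcases hd _ _ g1 T1 with e1 | e1 | e1 <;> rcases hd _ _ g2 T2 with e2 | e2 | e2 <;>
    first
    | exact m12 (e1.trans e2.symm)
    | rcases hd _ _ g3 T3 with e3 | e3 | e3 <;>
        first
        | exact m13 (e1.trans e3.symm)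
        | exact m23 (e2.trans e3.symm)
        | rcases hd _ _ g4 T4 with e4 | e4 | e4 <;>
            first
            | exact m14 (e1.trans e4.symm)
            | exact m24 (e2.trans e4.symm)
            | exact m34 (e3.trans e4.symm)

end

/-! ### From words and permutations to sequences and window sums. -/

section
variable {w : ℕ → Fin 2}

theorem Recurrent.recur (hw : Recurrent w) : Recur (toSeq w) := by
  intro i n N
  obtain ⟨j, hj, hN⟩ := (hw (wordAt w i n) ⟨i, by rw [length_wordAt]⟩).exists_gt N
  refine ⟨j, hN.le, fun k hk => (toSeq_inj w).2 ?_⟩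
  have hj' : wordAt w j (wordAt w i n).length = wordAt w i n := hj
  rw [length_wordAt, wordAt_eq_iff] at hj'
  exact hj' k hk

theorem count_wordAt (i n : ℕ) : ((wordAt w i n).count 1 : ℤ) = wsum (toSeq w) i n ∧
    (wordAt w i n).count 0 + (wordAt w i n).count 1 = n := by
  induction n with
  | zero => simp [wordAt, wsum_zero]
  | succ n ih =>
    rw [wordAt_succ, wsum_succ, List.count_append, List.count_append]
    rcases Fin.exists_fin_two.1 ⟨w (i + n), rfl⟩ with h | h
    · simp [h, toSeq, ih.1]; omega
    · simp [h, toSeq, ih.1]; omega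

theorem wordAt_perm_iff {i j n : ℕ} :
    (wordAt w i n).Perm (wordAt w j n) ↔ wsum (toSeq w) i n = wsum (toSeq w) j n := by
  obtain ⟨a1, a2⟩ := count_wordAt (w := w) i n
  obtain ⟨b1, b2⟩ := count_wordAt (w := w) j n
  rw [List.perm_iff_count, Fin.forall_fin_two]
  omega

theorem mem_semiAbelianReturns {n i₀ : ℕ} {r : List (Fin 2)} :
    r ∈ semiAbelianReturns w (wordAt w i₀ n) ↔
      ∃ i j, IsRet (toSeq w) n (wsum (toSeq w) i₀ n) i j ∧ r = wordAt w i (j - i) := by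
  have occ : ∀ i, i ∈ abelianOccurrences w (wordAt w i₀ n) ↔
      wsum (toSeq w) i n = wsum (toSeq w) i₀ n := by
    intro i
    show (wordAt w i (wordAt w i₀ n).length).Perm _ ↔ _
    rw [length_wordAt, wordAt_perm_iff]
  show (∃ i j, _) ↔ _
  simp only [occ, IsRet, and_assoc, ne_eq]

theorem wordAt_eq_iff_sameSeg {i j i' j' : ℕ} :
    wordAt w i (j - i) = wordAt w i' (j' - i') ↔ SameSeg (toSeq w) i j i' j' := by
  constructor
  · intro h
    have hl : j - i = j' - i' := by simpa [length_wordAt] using congrArg List.length h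
    rw [← hl, wordAt_eq_iff] at h
    exact ⟨hl, fun k hk => (toSeq_inj w).2 (h k hk)⟩
  · rintro ⟨hl, h⟩
    rw [← hl, wordAt_eq_iff]
    exact fun k hk => (toSeq_inj w).1 (h k hk)

theorem ncard_semiAbelianReturns (h3 : AtMostThree (toSeq w)) (h2 : AtLeastTwo (toSeq w))
    (u : List (Fin 2)) (hu : IsFactor w u) :
    (semiAbelianReturns w u).ncard = 2 ∨ (semiAbelianReturns w u).ncard = 3 := by
  obtain ⟨i₀, hi₀⟩ := hu
  rw [← hi₀]
  generalize u.length = n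
  obtain ⟨i₁, j₁, i₂, j₂, R1, R2, n12⟩ := h2 n i₀
  have m1 := mem_semiAbelianReturns.2 ⟨i₁, j₁, R1, rfl⟩
  have m2 := mem_semiAbelianReturns.2 ⟨i₂, j₂, R2, rfl⟩
  by_cases hsub : ∀ r ∈ semiAbelianReturns w (wordAt w i₀ n),
      r = wordAt w i₁ (j₁ - i₁) ∨ r = wordAt w i₂ (j₂ - i₂)
  · left
    rw [Set.ncard_eq_two]
    refine ⟨_, _, fun e => n12 (wordAt_eq_iff_sameSeg.1 e), Set.Subset.antisymm hsub ?_⟩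
    rintro r (rfl | rfl)
    exacts [m1, m2]
  · right
    push Not at hsub
    obtain ⟨r, hr, hr1, hr2⟩ := hsub
    obtain ⟨i₃, j₃, R3, rfl⟩ := mem_semiAbelianReturns.1 hr
    rw [Set.ncard_eq_three]
    refine ⟨_, _, _, fun e => n12 (wordAt_eq_iff_sameSeg.1 e), hr1.symm, hr2.symm,
      Set.Subset.antisymm ?_ ?_⟩
    · intro r hr
      by_contra hne
      simp only [Set.mem_insert_iff, Set.mem_singleton_iff, not_or] at hne
      obtain ⟨i₄, j₄, R4, rfl⟩ := mem_semiAbelianReturns.1 hr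
      simp only [wordAt_eq_iff_sameSeg] at hne
      exact h3 _ _ _ _ _ _ _ _ _ _ R1 R2 R3 R4 n12 (fun e => hr1 (wordAt_eq_iff_sameSeg.2 e.symm))
        (fun e => hne.1 e.symm) (fun e => hr2 (wordAt_eq_iff_sameSeg.2 e.symm)) (fun e => hne.2.1 e.symm)
        (fun e => hne.2.2 e.symm)
    · rintro r (rfl | rfl | rfl)
      exacts [m1, m2, hr]

theorem atMostThree_of_ncard (h : ∀ u : List (Fin 2), IsFactor w u →
    (semiAbelianReturns w u).ncard = 2 ∨ (semiAbelianReturns w u).ncard = 3) :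
    AtMostThree (toSeq w) := by
  intro n c i₁ j₁ i₂ j₂ i₃ j₃ i₄ j₄ R1 R2 R3 R4 n12 n13 n14 n23 n24 n34
  obtain rfl := R1.2.1
  have m1 := mem_semiAbelianReturns.2 ⟨i₁, j₁, R1, rfl⟩
  have m2 := mem_semiAbelianReturns.2 ⟨i₂, j₂, R2, rfl⟩
  have m3 := mem_semiAbelianReturns.2 ⟨i₃, j₃, R3, rfl⟩
  have m4 := mem_semiAbelianReturns.2 ⟨i₄, j₄, R4, rfl⟩
  have hcard := h (wordAt w i₁ n) ⟨i₁, by rw [length_wordAt]⟩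
  have hfin : (semiAbelianReturns w (wordAt w i₁ n)).Finite :=
    Set.finite_of_ncard_ne_zero (by omega)
  simp only [← wordAt_eq_iff_sameSeg] at n12 n13 n14 n23 n24 n34
  set F : Finset (List (Fin 2)) := {wordAt w i₁ (j₁ - i₁), wordAt w i₂ (j₂ - i₂),
    wordAt w i₃ (j₃ - i₃), wordAt w i₄ (j₄ - i₄)} with hF
  have hFcard : F.card = 4 := by
    rw [hF, Finset.card_insert_of_notMem, Finset.card_insert_of_notMem,
      Finset.card_pair n34] <;> simp [n12, n13, n14, n23, n24]
  have hsub : (F : Set (List (Fin 2))) ⊆ semiAbelianReturns w (wordAt w i₁ n) := by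
    intro r hr
    simp only [hF, Finset.coe_insert, Finset.coe_singleton, Set.mem_insert_iff,
      Set.mem_singleton_iff] at hr
    rcases hr with rfl | rfl | rfl | rfl
    exacts [m1, m2, m3, m4]
  have := Set.ncard_le_ncard hsub hfin
  rw [Set.ncard_coe_finset, hFcard] at this
  omega

theorem atLeastTwo_of_ncard (h : ∀ u : List (Fin 2), IsFactor w u →
    (semiAbelianReturns w u).ncard = 2 ∨ (semiAbelianReturns w u).ncard = 3) :
    AtLeastTwo (toSeq w) := by
  intro n i
  have hcard := h (wordAt w i n) ⟨i, by rw [length_wordAt]⟩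
  have hfin : (semiAbelianReturns w (wordAt w i n)).Finite :=
    Set.finite_of_ncard_ne_zero (by omega)
  obtain ⟨a, ha, b, hb, hab⟩ := (Set.one_lt_ncard hfin).1 (by omega)
  obtain ⟨i₁, j₁, R1, rfl⟩ := mem_semiAbelianReturns.1 ha
  obtain ⟨i₂, j₂, R2, rfl⟩ := mem_semiAbelianReturns.1 hb
  exact ⟨i₁, j₁, i₂, j₂, R1, R2, fun e => hab (wordAt_eq_iff_sameSeg.2 e)⟩

end
end AbelianReturns

theorem theorem3 (w : ℕ → Fin 2) (hw : AbelianReturns.Recurrent w) :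
    AbelianReturns.Sturmian w ↔
      ∀ u : List (Fin 2), AbelianReturns.IsFactor w u →
        (AbelianReturns.semiAbelianReturns w u).ncard = 2 ∨
          (AbelianReturns.semiAbelianReturns w u).ncard = 3 := by
  have hb := AbelianReturns.toSeq_binary w
  have hr := hw.recur
  constructor
  · intro hS
    have hu := (AbelianReturns.sturmian_iff w).1 hS
    have hap := hu.aperiodic
    have hbal := hu.balanced hb hr hS.fewFactors
    exact AbelianReturns.ncard_semiAbelianReturns (hbal.atMostThree hb hap hr) (hap.atLeastTwo hr)
  · intro h
    have h3 := AbelianReturns.atMostThree_of_ncard h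
    have h2 := AbelianReturns.atLeastTwo_of_ncard h
    have hbal := AbelianReturns.balanced_of_returns hb hr h3 h2
    have hap : AbelianReturns.Aperiodic (AbelianReturns.toSeq w) := by
      intro p hp
      by_contra hne
      push Not at hne
      exact h2.not_periodic hb hbal hp hne
    rw [AbelianReturns.sturmian_iff]
    exact fun n => ⟨hap.exists_rightSpecial hb hr n, fun i j hi hj =>
      hbal.rightSpecial_unique hb hi hj⟩
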